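/- **Conventions.** An $\omega$-category means a strict globular one in single-set form: a set $\mathcal{C}$ with sources and targets $s_n,t_n$ ($n\ge 0$) and partial compositions $x *_n y$ (defined when $t_n x=s_n y$), in which every element $x$ has a dimension, the least $n$ with $s_nx=t_nx=x$; an $n$-morphism is an element of dimension $n$. It is *non-contracting* if $s_1x$ and $t_1x$ are $1$-dimensional whenever $x$ is not $0$-dimensional. Then the elements of positive dimension form the path $\omega$-category $\mathbb{P}\mathcal{C}$, whose operations $s_n,t_n,*_n$ are $s_{n+1},t_{n+1},*_{n+1}$ of $\mathcal{C}$. Assume throughout that $\mathbb{P}\mathcal{C}$ is a strict $\omega$-groupoid: for every $n\ge0$, each of its elements is invertible for its $n$-th composition. Let $\Delta^n$ also denote the $\omega$-category freely generated by the faces of the $n$-simplex (the $n$-th oriental). The globular nerve $\mathcal{N}^{gl}(\mathcal{C})$ has as $n$-simplices ($n\ge0$) the $\omega$-functors $\Delta^n\to\mathbb{P}\mathcal{C}$. For $n\geq 1$ and a $1$-morphism $\phi$ of $\mathcal{C}$, regarded as a vertex of the nerve, put $\pi^{gl}_{n+1}(\mathcal{C},\phi)=\pi_n(\mathcal{N}^{gl}(\mathcal{C}),\phi)$,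 the simplicial homotopy group: its elements are the homotopy classes $[x]$ of $n$-simplices $x$ whose boundary is constant at $\phi$, and $[x][y]=[z]$ if and only if some $(n+1)$-simplex $w$ has $\partial_{n-1}w=x$, $\partial_{n+1}w=y$, $\partial_nw=z$ and all other faces constant at $\phi$. **Proposition.** Let $\mathcal{C}$ be a non-contracting $\omega$-category such that $\mathbb{P}\mathcal{C}$ is an $\omega$-groupoid, let $n\ge 1$, and let $\phi,\psi$ be $1$-morphisms of $\mathcal{C}$ such that $\phi *_0\psi$ is defined, i.e. $t_0\phi=s_0\psi$. Below, $x$ and $y$ are arbitrary $n$-simplices of $\mathcal{N}^{gl}(\mathcal{C})$ with boundary constant at $\phi$ and $\psi$ respectively; for them $x(c) *_0 y(c)$ is defined for every $c\in\Delta^n$. 1. If $\phi *_0\psi$ is $1$-dimensional, then the rule above does make $\pi^{gl}_{n+1}(\mathcal{C},\phi)$, $\pi^{gl}_{n+1}(\mathcal{C},\psi)$ and $\pi^{gl}_{n+1}(\mathcal{C},\phi *_0\psi)$ groups, $c\mapsto x(c) *_0 y(c)$ is an $n$-simplex $x *_0 y$ of $\mathcal{N}^{gl}(\mathcal{C})$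 with boundary constant at $\phi *_0\psi$, and $([x],[y])\mapsto[x *_0 y]$ is a well-defined homomorphism of groups $$\pi^{gl}_{n+1}(\mathcal{C},\phi)\times\pi^{gl}_{n+1}(\mathcal{C},\psi)\to\pi^{gl}_{n+1}(\mathcal{C},\phi *_0\psi).$$ 2. If $\phi *_0\psi$ is $0$-dimensional, then $x(c) *_0 y(c)=\phi *_0\psi$ for all such $x,y$ and all $c\in\Delta^n$; so $(x,y)\mapsto x *_0 y$ induces on $\pi^{gl}_{n+1}(\mathcal{C},\phi)\times\pi^{gl}_{n+1}(\mathcal{C},\psi)$ the constant map with value $\phi *_0\psi$. -/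

import Mathlib

/-!
Strict globular ω-categories in the single-set presentation, path ω-categories, orientals,
the globular simplicial nerve and its homotopy groups.
-/

universe u v w

/-- A (strict, globular) ω-category: a set `A` with operators `d false n = s_n` (the `n`-source)
and `d true n = t_n` (the `n`-target), and partial compositions `a *_n b`, defined exactly when
`t_n a = s_n b`. Every element has finite dimension. -/
class OmegaCat (A : Type u) where
  d : Bool → ℕ → A → A
  comp : (n : ℕ) → (a b : A) → d true n a = d false n b → A
  d_d_of_lt : ∀ (β α : Bool) (m n : ℕ) (x : A), m < n → d β m (d α n x) = d β m x
  d_d_of_le : ∀ (β α : Bool) (m n : ℕ) (x : A), n ≤ m → d β m (d α n x) = d α n x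
  src_comp : ∀ (n : ℕ) (x : A) (h : d true n (d false n x) = d false n x),
    comp n (d false n x) x h = x
  comp_tgt : ∀ (n : ℕ) (x : A) (h : d true n x = d false n (d true n x)),
    comp n x (d true n x) h = x
  src_of_comp : ∀ (n : ℕ) (x y : A) (h : d true n x = d false n y),
    d false n (comp n x y h) = d false n x
  tgt_of_comp : ∀ (n : ℕ) (x y : A) (h : d true n x = d false n y),
    d true n (comp n x y h) = d true n y
  d_comp : ∀ (α : Bool) (m n : ℕ) (x y : A), m ≠ n → ∀ (h : d true n x = d false n y)
    (h' : d true n (d α m x) = d false n (d α m y)),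
    d α m (comp n x y h) = comp n (d α m x) (d α m y) h'
  assoc : ∀ (n : ℕ) (x y z : A) (h₁ : d true n x = d false n y)
    (h₂ : d true n (comp n x y h₁) = d false n z) (h₃ : d true n y = d false n z)
    (h₄ : d true n x = d false n (comp n y z h₃)),
    comp n (comp n x y h₁) z h₂ = comp n x (comp n y z h₃) h₄
  interchange : ∀ (m n : ℕ) (x y z w : A), m ≠ n →
    ∀ (h₁ : d true n x = d false n y) (h₂ : d true n z = d false n w)
    (h₃ : d true m (comp n x y h₁) = d false m (comp n z w h₂))
    (h₄ : d true m x = d false m z) (h₅ : d true m y = d false m w)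
    (h₆ : d true n (comp m x z h₄) = d false n (comp m y w h₅)),
    comp m (comp n x y h₁) (comp n z w h₂) h₃ = comp n (comp m x z h₄) (comp m y w h₅) h₆
  exists_dim : ∀ x : A, ∃ n : ℕ, ∀ α : Bool, d α n x = x

namespace OmegaCat

/-- `x` has dimension `n`: `n` is the least number such that `s_n x = t_n x = x`. -/
def HasDim {A : Type u} [OmegaCat A] (x : A) (n : ℕ) : Prop :=
  IsLeast {k : ℕ | ∀ α : Bool, d α k x = x} n

/-- `C` is non-contracting: `s_1 x` and `t_1 x` are `1`-dimensional as soon as `x` is not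
`0`-dimensional. -/
class NonContracting (C : Type u) [OmegaCat C] : Prop where
  hasDim_one : ∀ x : C, ¬ HasDim x 0 → ∀ α : Bool, HasDim (d α 1 x) 1

/-- `A` is a strict globular ω-groupoid: every element has an inverse for each law `*_n`. -/
class IsOmegaGroupoid (A : Type u) [OmegaCat A] : Prop where
  exists_inv : ∀ (n : ℕ) (x : A), ∃ (y : A) (h₁ : d true n x = d false n y)
    (h₂ : d true n y = d false n x), comp n x y h₁ = d false n x ∧ comp n y x h₂ = d true n x

/-- ω-functors: maps commuting with sources, targets and compositions. -/
structure Fun (A : Type u) (B : Type v) [OmegaCat A] [OmegaCat B] where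
  toFun : A → B
  map_d : ∀ (α : Bool) (n : ℕ) (x : A), toFun (d α n x) = d α n (toFun x)
  map_comp : ∀ (n : ℕ) (x y : A) (h : d true n x = d false n y)
    (h' : d true n (toFun x) = d false n (toFun y)),
    toFun (comp n x y h) = comp n (toFun x) (toFun y) h'

instance {A : Type u} {B : Type v} [OmegaCat A] [OmegaCat B] : CoeFun (Fun A B) (fun _ => A → B) :=
  ⟨Fun.toFun⟩

theorem Fun.ext' {A : Type u} {B : Type v} [OmegaCat A] [OmegaCat B] {f g : Fun A B}
    (h : ∀ x, f x = g x) : f = g := by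
  cases f; cases g
  congr
  exact funext h

/-- Composition of ω-functors. -/
def Fun.comp {A : Type u} {B : Type v} {C : Type w} [OmegaCat A] [OmegaCat B] [OmegaCat C]
    (g : Fun B C) (f : Fun A B) : Fun A C where
  toFun x := g (f x)
  map_d α n x := by rw [f.map_d, g.map_d]
  map_comp n x y h h' := by
    have h'' : d true n (f x) = d false n (f y) := by rw [← f.map_d, ← f.map_d, h]
    rw [f.map_comp n x y h h'', g.map_comp n _ _ h'' h']

theorem comp_congr {A : Type u} [OmegaCat A] {n : ℕ} {a a' b b' : A} (ha : a = a') (hb : b = b')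
    (h : d true n a = d false n b) (h' : d true n a' = d false n b') :
    comp n a b h = comp n a' b' h' := by
  subst ha hb; rfl

/-- The constant ω-functor at a `0`-dimensional element. -/
def Fun.const (A : Type u) {B : Type v} [OmegaCat A] [OmegaCat B] (b : B)
    (hb : ∀ α : Bool, d α 0 b = b) : Fun A B where
  toFun _ := b
  map_d α n x := by
    conv_rhs => rw [← hb α, d_d_of_le _ _ _ _ _ (Nat.zero_le n), hb α]
  map_comp n x y h h' := by
    have hs : d false n b = b := by
      conv_lhs => rw [← hb false, d_d_of_le _ _ _ _ _ (Nat.zero_le n), hb false]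
    have key : OmegaCat.comp n (d false n b) b (by rw [hs, h', hs]) = b := src_comp n b _
    exact key.symm.trans (comp_congr hs rfl _ _)

/-! ### The path ω-category -/

theorem hasDim_zero_iff {A : Type u} [OmegaCat A] (x : A) : HasDim x 0 ↔ ∀ α, d α 0 x = x :=
  ⟨fun h => h.1, fun h => ⟨h, fun _ _ => Nat.zero_le _⟩⟩

theorem d_of_d_zero {A : Type u} [OmegaCat A] {x : A} (h : ∀ α, d α 0 x = x) (α : Bool) (n : ℕ) :
    d α n x = x := by
  conv_lhs => rw [← h α, d_d_of_le _ _ _ _ _ (Nat.zero_le n), h α]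

theorem not_hasDim_zero_of_d_one {C : Type u} [OmegaCat C] [NonContracting C] {x y : C}
    (hx : ¬ HasDim x 0) (α : Bool) (h : d α 1 y = d α 1 x) : ¬ HasDim y 0 := by
  intro hy
  have h1 := NonContracting.hasDim_one x hx α
  rw [← h, d_of_d_zero ((hasDim_zero_iff y).1 hy)] at h1
  exact Nat.not_succ_le_zero 0 (h1.2 ((hasDim_zero_iff y).1 hy))

theorem not_hasDim_zero_d {C : Type u} [OmegaCat C] [NonContracting C] {x : C}
    (hx : ¬ HasDim x 0) (α : Bool) (n : ℕ) : ¬ HasDim (d α (n + 1) x) 0 := by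
  refine not_hasDim_zero_of_d_one hx α ?_
  rcases Nat.eq_zero_or_pos n with rfl | hn
  · exact d_d_of_le _ _ _ _ _ le_rfl
  · exact d_d_of_lt _ _ _ _ _ (by omega)

theorem not_hasDim_zero_comp {C : Type u} [OmegaCat C] [NonContracting C] {x y : C}
    (hx : ¬ HasDim x 0) (n : ℕ) (h : d true (n + 1) x = d false (n + 1) y) :
    ¬ HasDim (comp (n + 1) x y h) 0 := by
  refine not_hasDim_zero_of_d_one hx false ?_
  rcases Nat.eq_zero_or_pos n with rfl | hn
  · exact src_of_comp _ _ _ _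
  · have hxy : d false 1 x = d false 1 y := by
      rw [← d_d_of_lt false true 1 (n + 1) x (by omega), h, d_d_of_lt _ _ _ _ _ (by omega)]
    have e1 : d true (n + 1) (d false 1 x) = d false 1 x := d_d_of_le _ _ _ _ _ (by omega)
    have e2 : d false (n + 1) (d false 1 x) = d false 1 x := d_d_of_le _ _ _ _ _ (by omega)
    rw [d_comp false 1 (n + 1) x y (by omega) h (by rw [← hxy, e1, e2])]
    have key : comp (n + 1) (d false (n + 1) (d false 1 x)) (d false 1 x) (by rw [e2, e1])
      = d false 1 x := src_comp _ _ _
    exact (comp_congr e2.symm hxy.symm _ _).trans key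

/-- The underlying set of the path ω-category of `C`: the elements that are not
`0`-dimensional. -/
def PathCat (C : Type u) [OmegaCat C] : Type u := {x : C // ¬ HasDim x 0}

/-- The path ω-category of a non-contracting ω-category: its `n`-source, `n`-target and
`n`-composition are the `(n+1)`-source, `(n+1)`-target and `(n+1)`-composition of `C`. -/
instance (C : Type u) [OmegaCat C] [NonContracting C] : OmegaCat (PathCat C) where
  d α n x := ⟨d α (n + 1) x.1, not_hasDim_zero_d x.2 α n⟩
  comp n a b h := ⟨comp (n + 1) a.1 b.1 (congrArg Subtype.val h),
    not_hasDim_zero_comp a.2 n (congrArg Subtype.val h)⟩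
  d_d_of_lt β α m n x h := Subtype.ext (d_d_of_lt β α _ _ x.1 (by omega))
  d_d_of_le β α m n x h := Subtype.ext (d_d_of_le β α _ _ x.1 (by omega))
  src_comp n x h := Subtype.ext (src_comp (n + 1) x.1 _)
  comp_tgt n x h := Subtype.ext (comp_tgt (n + 1) x.1 _)
  src_of_comp n x y h := Subtype.ext (src_of_comp (n + 1) x.1 y.1 _)
  tgt_of_comp n x y h := Subtype.ext (tgt_of_comp (n + 1) x.1 y.1 _)
  d_comp α m n x y hmn h h' := Subtype.ext
    (d_comp α (m + 1) (n + 1) x.1 y.1 (by omega) _ (congrArg Subtype.val h'))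
  assoc n x y z h₁ h₂ h₃ h₄ := Subtype.ext
    (assoc (n + 1) x.1 y.1 z.1 _ (congrArg Subtype.val h₂) _ (congrArg Subtype.val h₄))
  interchange m n x y z w hmn h₁ h₂ h₃ h₄ h₅ h₆ := Subtype.ext
    (interchange (m + 1) (n + 1) x.1 y.1 z.1 w.1 (by omega) _ _ (congrArg Subtype.val h₃) _ _
      (congrArg Subtype.val h₆))
  exists_dim x := by
    obtain ⟨n, hn⟩ := exists_dim x.1
    refine ⟨n, fun α => Subtype.ext ?_⟩
    change d α (n + 1) x.1 = x.1
    conv_lhs => rw [← hn α, d_d_of_le _ _ _ _ _ (Nat.le_succ n), hn α]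

/-- A `1`-dimensional element of `C`, as an element of the path ω-category. -/
def PathCat.ofArrow {C : Type u} [OmegaCat C] (φ : C) (hφ : HasDim φ 1) : PathCat C :=
  ⟨φ, fun h => Nat.not_succ_le_zero 0 (hφ.2 h.1)⟩

theorem PathCat.d_ofArrow {C : Type u} [OmegaCat C] [NonContracting C] (φ : C) (hφ : HasDim φ 1)
    (α : Bool) : d α 0 (PathCat.ofArrow φ hφ) = PathCat.ofArrow φ hφ :=
  Subtype.ext (hφ.1 α)

end OmegaCat

/-! ### The orientals

The ω-category `Δⁿ` freely generated by the faces of the `n`-simplex, in its description by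
chains: faces of dimension `p` are the subsets of `{0, …, n}` with `p + 1` elements, and an
element is a sequence of pairs `(x_p^-, x_p^+)` of `p`-chains with coefficients in `ℕ` (the
collections of `p`-dimensional faces occurring in its `p`-source and in its `p`-target), with
`x_0^±` a single vertex and `∂ x_{p+1}^± = x_p^+ - x_p^-`. The boundary of a face is the sum of
the faces in its target (those omitting a vertex in an even position, positions being
counted from `1`) minus the sum of the faces in its source (those omitting a vertex in an odd
position). -/

namespace Oriental

open Finset

variable {V : Type v} {W : Type w} [LinearOrder V] [Fintype V] [LinearOrder W] [Fintype W]

/-- The coefficient of the face `τ` in the boundary of `τ ∪ {v}`, for `v ∉ τ`. -/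
def faceSign (τ : Finset V) (v : V) : ℤ := if Even (#(τ.filter (· < v))) then -1 else 1

/-- The boundary of a chain (target minus source). -/
def bdry (c : Finset V → ℤ) (τ : Finset V) : ℤ := ∑ v ∈ τᶜ, faceSign τ v * c (insert v τ)

/-- The map of chains induced by a map of vertices: a face on which `f` is not injective goes
to `0`. -/
def push {R : Type*} [AddCommMonoid R] (f : V → W) (c : Finset V → R) (τ : Finset W) : R :=
  ∑ σ : Finset V, if σ.image f = τ ∧ #σ = #τ then c σ else 0

theorem push_cast_int (f : V → W) (c : Finset V → ℕ) (τ : Finset W) :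
    ((push f c τ : ℕ) : ℤ) = push f (fun σ => (c σ : ℤ)) τ := by
  simp only [push, Nat.cast_sum]
  exact sum_congr rfl fun σ _ => by split_ifs <;> simp

theorem push_id {R : Type*} [AddCommMonoid R] (c : Finset V → R) : push id c = c := by
  funext τ
  simp only [push, image_id]
  rw [sum_eq_single τ] <;> simp +contextual

theorem push_push {R : Type*} [AddCommMonoid R] {U : Type*} [LinearOrder U] [Fintype U]
    (f : V → W) (g : W → U) (c : Finset V → R) : push g (push f c) = push (g ∘ f) c := by
  funext ρ
  simp only [push]
  have : ∀ τ : Finset W, (if τ.image g = ρ ∧ #τ = #ρ then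
      ∑ σ : Finset V, (if σ.image f = τ ∧ #σ = #τ then c σ else 0) else 0)
      = ∑ σ : Finset V, if (τ.image g = ρ ∧ #τ = #ρ) ∧ (σ.image f = τ ∧ #σ = #τ)
        then c σ else 0 := by
    intro τ
    split_ifs with h
    · simp [h]
    · simp [h]
  simp_rw [this]
  rw [sum_comm]
  refine sum_congr rfl fun σ _ => ?_
  rw [sum_eq_single (σ.image f)]
  · rw [← image_image]
    refine if_congr ?_ rfl rfl
    constructor
    · rintro ⟨⟨h1, h2⟩, -, h3⟩
      exact ⟨h1, h3.trans h2⟩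
    · rintro ⟨h1, h2⟩
      have e1 : #(σ.image f) ≤ #σ := card_image_le
      have e2 : #((σ.image f).image g) ≤ #(σ.image f) := card_image_le
      rw [h1] at e2
      exact ⟨⟨h1, by omega⟩, rfl, by omega⟩
  · intro τ _ h
    rw [if_neg]
    exact fun h' => h h'.2.1.symm
  · simp

/-- The map of chains induced by a monotone map commutes with the boundary. -/
theorem bdry_push (f : V → W) (hf : Monotone f) (c : Finset V → ℤ) (τ : Finset W) :
    bdry (push f c) τ = push f (bdry c) τ := by
  -- both sides are sums over pairs
  have hL : bdry (push f c) τ = ∑ p : W × Finset V,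
      if p.1 ∉ τ ∧ p.2.image f = insert p.1 τ ∧ #p.2 = #τ + 1 then faceSign τ p.1 * c p.2
      else 0 := by
    rw [Fintype.sum_prod_type]
    simp only [bdry, push]
    rw [← sum_filter_add_sum_filter_not univ (fun v => v ∉ τ)]
    have h0 : (∑ x ∈ univ.filter (fun v => ¬ v ∉ τ), ∑ y : Finset V,
      if x ∉ τ ∧ y.image f = insert x τ ∧ #y = #τ + 1 then faceSign τ x * c y else 0) = 0 := by
      refine sum_eq_zero fun x hx => sum_eq_zero fun y _ => ?_
      rw [if_neg]
      simp only [mem_filter, mem_univ, true_and, not_not] at hx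
      simp [hx]
    rw [h0, add_zero]
    have : univ.filter (fun v => v ∉ τ) = τᶜ := by ext; simp
    rw [this]
    refine sum_congr rfl fun v hv => ?_
    rw [mul_sum]
    refine sum_congr rfl fun σ _ => ?_
    have hv' : v ∉ τ := by simpa using hv
    rw [card_insert_of_notMem hv']
    simp only [hv', not_false_eq_true, true_and]
    split_ifs <;> simp
  have hR : push f (bdry c) τ = ∑ q : V × Finset V,
      if q.1 ∉ q.2 ∧ q.2.image f = τ ∧ #q.2 = #τ then faceSign q.2 q.1 * c (insert q.1 q.2)
      else 0 := by
    rw [Fintype.sum_prod_type_right]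
    simp only [bdry, push]
    refine sum_congr rfl fun ρ _ => ?_
    split_ifs with h
    · simp only [h, and_true]
      rw [← sum_filter]
      refine sum_congr ?_ fun _ _ => rfl
      ext; simp
    · simp [h]
  -- the part with `f q.1 ∈ τ` cancels
  rw [hL, hR, ← sum_filter, ← sum_filter,
    ← sum_filter_add_sum_filter_not (univ.filter _) (fun q : V × Finset V => f q.1 ∉ τ)]
  have hinj : ∀ ρ : Finset V, ρ.image f = τ → #ρ = #τ → Set.InjOn f ρ := by
    intro ρ h1 h2
    exact card_image_iff.1 (by rw [h1, h2])
  have hcancel : (∑ q ∈ (univ.filter (fun q : V × Finset V =>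
      q.1 ∉ q.2 ∧ q.2.image f = τ ∧ #q.2 = #τ)).filter (fun q => ¬ f q.1 ∉ τ),
      faceSign q.2 q.1 * c (insert q.1 q.2)) = 0 := by
    have hex : ∀ q ∈ (univ.filter (fun q : V × Finset V =>
      q.1 ∉ q.2 ∧ q.2.image f = τ ∧ #q.2 = #τ)).filter (fun q => ¬ f q.1 ∉ τ),
        ∃ u ∈ q.2, f u = f q.1 := by
      intro q hq
      simp only [mem_filter, mem_univ, true_and, not_not] at hq
      have := hq.2
      rw [← hq.1.2.1, mem_image] at this
      exact this
    have hex' : ∀ q : V × Finset V, ∃ u : V, q ∈ (univ.filter (fun q : V × Finset V =>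
      q.1 ∉ q.2 ∧ q.2.image f = τ ∧ #q.2 = #τ)).filter (fun q => ¬ f q.1 ∉ τ) →
        u ∈ q.2 ∧ f u = f q.1 := by
      intro q
      by_cases hq : q ∈ (univ.filter (fun q : V × Finset V =>
        q.1 ∉ q.2 ∧ q.2.image f = τ ∧ #q.2 = #τ)).filter (fun q => ¬ f q.1 ∉ τ)
      · obtain ⟨u, hu⟩ := hex q hq
        exact ⟨u, fun _ => hu⟩
      · exact ⟨q.1, fun h => absurd h hq⟩
    choose g hg using hex'
    have hmem : ∀ q, ∀ hq : q ∈ (univ.filter (fun q : V × Finset V =>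
      q.1 ∉ q.2 ∧ q.2.image f = τ ∧ #q.2 = #τ)).filter (fun q => ¬ f q.1 ∉ τ),
        (g q, (insert q.1 q.2).erase (g q)) ∈ (univ.filter (fun q : V × Finset V =>
      q.1 ∉ q.2 ∧ q.2.image f = τ ∧ #q.2 = #τ)).filter (fun q => ¬ f q.1 ∉ τ) := by
      intro q hq
      obtain ⟨hg1, hg2⟩ := hg q hq
      simp only [mem_filter, mem_univ, true_and, not_not] at hq ⊢
      obtain ⟨⟨a, b, e⟩, k⟩ := hq
      have hne : q.1 ≠ g q := fun h => a (h ▸ hg1)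
      refine ⟨⟨by simp, ?_, ?_⟩, hg2 ▸ k⟩
      · ext y
        simp only [mem_image, mem_erase, mem_insert]
        constructor
        · rintro ⟨x, ⟨h1, rfl | h2⟩, rfl⟩
          · exact k
          · exact b ▸ mem_image_of_mem f h2
        · intro hy
          rw [← b, mem_image] at hy
          obtain ⟨x, hx, rfl⟩ := hy
          by_cases h : x = g q
          · exact ⟨q.1, ⟨hne, Or.inl rfl⟩, by rw [h, hg2]⟩
          · exact ⟨x, ⟨h, Or.inr hx⟩, rfl⟩
      · rw [card_erase_of_mem (mem_insert_of_mem hg1), card_insert_of_notMem a, ← e]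
        simp
    have hsign : ∀ (ρ : Finset V) (u u' : V), Set.InjOn f ρ → u ∉ ρ → u' ∈ ρ → f u' = f u →
        u < u' → faceSign ρ u + faceSign ((insert u ρ).erase u') u' = 0 := by
      intro ρ u u' hi hu hu' hff hlt
      have : ((insert u ρ).erase u').filter (· < u') = insert u (ρ.filter (· < u)) := by
        ext y
        simp only [mem_filter, mem_erase, mem_insert]
        constructor
        · rintro ⟨⟨h1, rfl | h2⟩, h3⟩
          · exact Or.inl rfl
          · refine Or.inr ⟨h2, ?_⟩
            by_contra hc
            rw [not_lt] at hc
            exact h1 (hi h2 hu' (le_antisymm (hf h3.le) (hff ▸ hf hc)))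
        · rintro (rfl | ⟨h1, h2⟩)
          · exact ⟨⟨hlt.ne, Or.inl rfl⟩, hlt⟩
          · exact ⟨⟨(h2.trans hlt).ne, Or.inr h1⟩, h2.trans hlt⟩
      simp only [faceSign]
      rw [this, card_insert_of_notMem (by simp [hu])]
      simp only [Nat.even_add_one]
      split_ifs <;> simp_all
    have hback : ∀ (ρ : Finset V) (u u' : V), u ∉ ρ → u' ∈ ρ →
        (insert u' ((insert u ρ).erase u')).erase u = ρ := by
      intro ρ u u' hu hu'
      rw [insert_erase (mem_insert_of_mem hu'), erase_insert hu]
    refine sum_involution (fun q _ => (g q, (insert q.1 q.2).erase (g q))) ?_ ?_ hmem ?_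
    · intro q hq
      obtain ⟨hg1, hg2⟩ := hg q hq
      simp only [mem_filter, mem_univ, true_and, not_not] at hq
      obtain ⟨⟨a, b, e⟩, k⟩ := hq
      have hi := hinj q.2 b e
      dsimp only
      rw [insert_erase (mem_insert_of_mem hg1), ← add_mul]
      have hne : q.1 ≠ g q := fun h => a (h ▸ hg1)
      rcases lt_or_gt_of_ne hne with h | h
      · rw [hsign _ _ _ hi a hg1 hg2 h, zero_mul]
      · have hm := hmem q (by simp [a, b, e, k])
        simp only [mem_filter, mem_univ, true_and, not_not] at hm
        have := hsign ((insert q.1 q.2).erase (g q)) (g q) q.1 (hinj _ hm.1.2.1 hm.1.2.2)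
          (by simp) (by simp [hne]) hg2.symm h
        rw [hback _ _ _ a hg1, add_comm] at this
        rw [this, zero_mul]
    · intro q hq _ h
      obtain ⟨hg1, hg2⟩ := hg q hq
      simp only [mem_filter, mem_univ, true_and, not_not] at hq
      have h' : g q = q.1 := congrArg Prod.fst h
      exact hq.1.1 (h' ▸ hg1)
    · intro q hq
      have hm := hmem q hq
      obtain ⟨hg1, hg2⟩ := hg q hq
      obtain ⟨hg3, hg4⟩ := hg _ hm
      simp only [mem_filter, mem_univ, true_and, not_not] at hq hm
      have hne : q.1 ≠ g q := fun h => hq.1.1 (h ▸ hg1)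
      have h1 : g (g q, (insert q.1 q.2).erase (g q)) = q.1 :=
        hinj _ hm.1.2.1 hm.1.2.2 hg3 (by simp [hne]) (hg4.trans hg2)
      refine Prod.ext h1 ?_
      simp only [h1]
      exact hback _ _ _ hq.1.1 hg1
  rw [hcancel, add_zero]
  -- the remaining parts correspond bijectively
  symm
  have hmono : ∀ (ρ : Finset V) (u : V), ρ.image f = τ → #ρ = #τ → f u ∉ τ →
      faceSign ρ u = faceSign τ (f u) := by
    intro ρ u h1 h2 hu
    have hi := hinj ρ h1 h2
    have : τ.filter (· < f u) = (ρ.filter (· < u)).image f := by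
      ext y
      simp only [mem_filter, mem_image]
      constructor
      · rintro ⟨hy, hlt⟩
        rw [← h1, mem_image] at hy
        obtain ⟨x, hx, rfl⟩ := hy
        exact ⟨x, ⟨hx, lt_of_not_ge fun h => absurd (hf h) (not_le.2 hlt)⟩, rfl⟩
      · rintro ⟨x, ⟨hx, hlt⟩, rfl⟩
        have hxτ : f x ∈ τ := h1 ▸ mem_image_of_mem f hx
        exact ⟨hxτ, lt_of_le_of_ne (hf hlt.le) fun h => hu (h ▸ hxτ)⟩
    rw [faceSign, faceSign, this, card_image_of_injOn (hi.mono (by exact_mod_cast filter_subset _ _))]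
  refine sum_bij (fun q _ => (f q.1, insert q.1 q.2)) ?_ ?_ ?_ ?_
  · intro q hq
    simp only [mem_filter, mem_univ, true_and] at hq ⊢
    obtain ⟨⟨a, b, e⟩, k⟩ := hq
    exact ⟨k, by rw [image_insert, b], by rw [card_insert_of_notMem a, e]⟩
  · rintro ⟨u, ρ⟩ hq ⟨u', ρ'⟩ hq' h
    simp only [mem_filter, mem_univ, true_and] at hq hq'
    obtain ⟨⟨a, b, e⟩, k⟩ := hq
    obtain ⟨⟨a', b', e'⟩, k'⟩ := hq'
    obtain ⟨h1, h2⟩ := Prod.mk.inj h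
    have hu : u = u' := by
      have : u ∈ insert u' ρ' := h2 ▸ mem_insert_self u ρ
      rcases mem_insert.1 this with h | h
      · exact h
      · exact absurd (b' ▸ mem_image_of_mem f h) k
    subst hu
    have : ρ = ρ' := by rw [← erase_insert a, ← erase_insert a', h2]
    rw [this]
  · rintro ⟨v, σ⟩ hp
    simp only [mem_filter, mem_univ, true_and] at hp
    obtain ⟨a, b, e⟩ := hp
    have hv : v ∈ σ.image f := b ▸ mem_insert_self v τ
    obtain ⟨u, hu, rfl⟩ := mem_image.1 hv
    have hi : Set.InjOn f σ := card_image_iff.1 (by rw [b, e, card_insert_of_notMem a])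
    refine ⟨(u, σ.erase u), ?_, ?_⟩
    · simp only [mem_filter, mem_univ, true_and]
      refine ⟨⟨by simp, ?_, by rw [card_erase_of_mem hu, e]; simp⟩, a⟩
      ext y
      simp only [mem_image, mem_erase]
      constructor
      · rintro ⟨x, ⟨h1, h2⟩, rfl⟩
        have : f x ∈ insert (f u) τ := b ▸ mem_image_of_mem f h2
        rcases mem_insert.1 this with h | h
        · exact absurd (hi h2 hu h) h1
        · exact h
      · intro hy
        have : y ∈ σ.image f := b ▸ mem_insert_of_mem hy
        obtain ⟨x, hx, rfl⟩ := mem_image.1 this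
        exact ⟨x, ⟨fun h => a (h ▸ hy), hx⟩, rfl⟩
    · simp only [insert_erase hu]
  · intro q hq
    simp only [mem_filter, mem_univ, true_and] at hq
    obtain ⟨⟨a, b, e⟩, k⟩ := hq
    rw [hmono q.2 q.1 b e k]

end Oriental

/-- The elements of the ω-category `Δⁿ` (the `n`-th oriental): `cell false p` and `cell true p` are
the chains `x_p^-` and `x_p^+`. -/
@[ext]
structure Oriental (n : ℕ) where
  cell : Bool → ℕ → Finset (Fin (n + 1)) → ℕ
  card_eq : ∀ (α : Bool) (p : ℕ) (σ : Finset (Fin (n + 1))), cell α p σ ≠ 0 → σ.card = p + 1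
  sum_zero : ∀ α : Bool, ∑ σ, cell α 0 σ = 1
  bdry_succ : ∀ (α : Bool) (p : ℕ) (τ : Finset (Fin (n + 1))),
    Oriental.bdry (fun σ => (cell α (p + 1) σ : ℤ)) τ = cell true p τ - cell false p τ

namespace Oriental

open OmegaCat

theorem bdry_zero {n : ℕ} (τ : Finset (Fin (n + 1))) : bdry (fun _ => (0 : ℤ)) τ = 0 := by
  simp [bdry]

theorem bdry_add {n : ℕ} (c e : Finset (Fin (n + 1)) → ℤ) (τ : Finset (Fin (n + 1))) :
    bdry (fun σ => c σ + e σ) τ = bdry c τ + bdry e τ := by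
  simp [bdry, mul_add, Finset.sum_add_distrib]

/-- The `m`-source (`α = false`) and `m`-target (`α = true`): truncation at dimension `m`. -/
def face {n : ℕ} (α : Bool) (m : ℕ) (x : Oriental n) : Oriental n where
  cell β p := if p < m then x.cell β p else if p = m then x.cell α p else fun _ => 0
  card_eq β p σ h := by
    split_ifs at h
    · exact x.card_eq _ _ _ h
    · exact x.card_eq _ _ _ h
    · exact absurd rfl h
  sum_zero β := by
    rcases Nat.eq_zero_or_pos m with rfl | hm
    · simp [x.sum_zero]
    · simp [hm, x.sum_zero]
  bdry_succ β p τ := by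
    rcases lt_trichotomy (p + 1) m with h | h | h
    · simp only [h, show p < m by omega, if_true]
      exact x.bdry_succ β p τ
    · subst h
      simp only [lt_irrefl, if_true, if_false, Nat.lt_succ_self]
      exact x.bdry_succ α p τ
    · simp only [show ¬ p + 1 < m by omega, show ¬ p + 1 = m by omega, show ¬ p < m by omega,
        if_false]
      simp [bdry_zero]

theorem cell_eq_of_lt {n m : ℕ} {a b : Oriental n} (h : face true m a = face false m b) (β : Bool)
    {p : ℕ} (hp : p < m) : a.cell β p = b.cell β p := by
  have := congrFun (congrFun (congrArg Oriental.cell h) β) p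
  simpa [face, hp] using this

theorem cell_eq {n m : ℕ} {a b : Oriental n} (h : face true m a = face false m b) :
    a.cell true m = b.cell false m := by
  have := congrFun (congrFun (congrArg Oriental.cell h) true) m
  simpa [face] using this

/-- The composition `a *_m b`: the common source-target is shared in dimensions below `m`, the
chains are added in dimensions above `m`. -/
def compose {n : ℕ} (m : ℕ) (a b : Oriental n) (h : face true m a = face false m b) :
    Oriental n where
  cell β p := if p < m then a.cell β p else if p = m then
    (if β then b.cell β p else a.cell β p) else fun σ => a.cell β p σ + b.cell β p σ
  card_eq β p σ hσ := by
    split_ifs at hσ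
    · exact a.card_eq _ _ _ hσ
    · exact b.card_eq _ _ _ hσ
    · exact a.card_eq _ _ _ hσ
    · by_cases h' : a.cell β p σ = 0
      · exact b.card_eq β p σ (by simpa [h'] using hσ)
      · exact a.card_eq _ _ _ h'
  sum_zero β := by
    rcases Nat.eq_zero_or_pos m with rfl | hm
    · cases β <;> simp [a.sum_zero, b.sum_zero]
    · simp [hm, a.sum_zero]
  bdry_succ β p τ := by
    rcases lt_trichotomy (p + 1) m with h1 | h1 | h1
    · simp only [h1, show p < m by omega, if_true]
      exact a.bdry_succ β p τ
    · subst h1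
      simp only [lt_irrefl, if_true, if_false, Nat.lt_succ_self]
      cases β
      · simp only [Bool.false_eq_true, if_false]
        exact a.bdry_succ _ _ _
      · simp only [if_true]
        rw [cell_eq_of_lt h _ (Nat.lt_succ_self p), cell_eq_of_lt h _ (Nat.lt_succ_self p)]
        exact b.bdry_succ _ _ _
    · simp only [show ¬ p + 1 < m by omega, show ¬ p + 1 = m by omega, show ¬ p < m by omega,
        if_false, Nat.cast_add]
      rw [bdry_add, a.bdry_succ, b.bdry_succ]
      by_cases h2 : p = m
      · subst h2
        simp only [if_true, Bool.false_eq_true, if_false]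
        rw [cell_eq h]; ring
      · simp only [h2, if_false]
        push_cast; ring

/-- The ω-category structure of `Δⁿ`. -/
instance (n : ℕ) : OmegaCat (Oriental n) where
  d := face
  comp := compose
  d_d_of_lt β α m k x h := by
    ext γ p σ
    simp only [face]
    split_ifs <;> first | rfl | omega
  d_d_of_le β α m k x h := by
    ext γ p σ
    simp only [face]
    split_ifs <;> first | rfl | omega
  src_comp m x h := by
    ext γ p σ
    simp only [face, compose]
    split_ifs <;> first | rfl | omega | simp_all
  comp_tgt m x h := by
    ext γ p σ
    simp only [face, compose]
    split_ifs <;> first | rfl | omega | simp_all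
  src_of_comp m x y h := by
    ext γ p σ
    simp only [face, compose]
    split_ifs <;> first | rfl | omega | simp_all
  tgt_of_comp m x y h := by
    ext γ p σ
    simp only [face, compose]
    split_ifs with h1 <;> first | rfl | omega | skip
    rw [cell_eq_of_lt h _ h1]
  d_comp α m k x y hmk h h' := by
    ext γ p σ
    simp only [face, compose]
    split_ifs <;> first | rfl | omega
  assoc m x y z h₁ h₂ h₃ h₄ := by
    ext γ p σ
    simp only [compose]
    split_ifs <;> first | rfl | omega | (simp_all; done) | (exact Nat.add_assoc _ _ _)
  interchange m k x y z w hmk h₁ h₂ h₃ h₄ h₅ h₆ := by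
    ext γ p σ
    simp only [compose]
    split_ifs <;> first | rfl | omega | (simp_all; done) | (exact Nat.add_add_add_comm _ _ _ _)
  exists_dim x := by
    refine ⟨n + 1, fun α => ?_⟩
    ext γ p σ
    have hz : ∀ β : Bool, n + 1 ≤ p → x.cell β p σ = 0 := by
      intro β hp
      by_contra hne
      have h1 := x.card_eq β p σ hne
      have h2 := Finset.card_le_univ σ
      simp only [Fintype.card_fin] at h2
      omega
    simp only [face]
    split_ifs with h1 h2
    · rfl
    · rw [hz α (by omega), hz γ (by omega)]
    · rw [hz γ (by omega)]

/-- The ω-functor `Δᵐ → Δⁿ` induced by a monotone map of vertices. -/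
def map {m n : ℕ} (f : Fin (m + 1) →o Fin (n + 1)) : Fun (Oriental m) (Oriental n) where
  toFun x :=
    { cell := fun α p => push f (x.cell α p)
      card_eq := by
        intro α p τ h
        obtain ⟨σ, -, hσ⟩ := Finset.exists_ne_zero_of_sum_ne_zero h
        split_ifs at hσ with h'
        · rw [← h'.2]; exact x.card_eq α p σ hσ
        · exact absurd rfl hσ
      sum_zero := by
        intro α
        refine Eq.trans ?_ (x.sum_zero α)
        simp only [push]
        rw [Finset.sum_comm]
        refine Finset.sum_congr rfl fun σ _ => ?_
        by_cases h : x.cell α 0 σ = 0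
        · simp [h]
        · obtain ⟨u, rfl⟩ := Finset.card_eq_one.1 (x.card_eq α 0 σ h)
          rw [Finset.sum_eq_single {f u}]
          · simp
          · intro τ _ hτ
            rw [if_neg]
            rintro ⟨h1, -⟩
            exact hτ (by rw [← h1, Finset.image_singleton])
          · simp
      bdry_succ := by
        intro α p τ
        simp only [push_cast_int]
        rw [bdry_push f f.monotone]
        have : bdry (fun σ => (x.cell α (p + 1) σ : ℤ))
            = fun σ => (x.cell true p σ : ℤ) - x.cell false p σ :=
          funext (x.bdry_succ α p)
        rw [this]
        simp only [push]
        rw [← Finset.sum_sub_distrib]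
        exact Finset.sum_congr rfl fun σ _ => by split_ifs <;> simp }
  map_d α k x := by
    ext β p σ
    change push f ((face α k x).cell β p) σ = (if p < k then push f (x.cell β p)
      else if p = k then push f (x.cell α p) else fun _ => 0) σ
    simp only [face]
    split_ifs <;> simp [push]
  map_comp k x y h h' := by
    ext β p σ
    change push f ((compose k x y h).cell β p) σ = (if p < k then push f (x.cell β p)
      else if p = k then (if β then push f (y.cell β p) else push f (x.cell β p))
      else fun τ => push f (x.cell β p) τ + push f (y.cell β p) τ) σ
    simp only [compose]
    split_ifs <;> try rfl
    simp only [push]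
    rw [← Finset.sum_add_distrib]
    exact Finset.sum_congr rfl fun τ _ => by split_ifs <;> simp

end Oriental

/-! ### Nerves and homotopy groups -/

section Nerve

open CategoryTheory Simplicial

/-- The simplicial nerve of an ω-category: its `n`-simplices are the ω-functors `Δⁿ → A`. -/
def simplicialNerve (A : Type u) [OmegaCat A] : SSet.{u} where
  obj m := OmegaCat.Fun (Oriental m.unop.len) A
  map f := ↾fun x => x.comp (Oriental.map f.unop.toOrderHom)
  map_id m := by
    ext x
    refine OmegaCat.Fun.ext' fun c => congrArg x.toFun ?_
    ext α p σ
    exact congrFun (Oriental.push_id (c.cell α p)) σ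
  map_comp f g := by
    ext x
    refine OmegaCat.Fun.ext' fun c => congrArg x.toFun ?_
    ext α p σ
    exact (congrFun (Oriental.push_push g.unop.toOrderHom f.unop.toOrderHom (c.cell α p)) σ).symm

/-- The set of homotopy classes of `n`-simplices of `K` whose boundary is at the base-point `x`,
two such simplices `f` and `g` being homotopic when they are the faces `∂_n w` and `∂_{n+1} w` of
an `(n+1)`-simplex `w` whose other faces are at the base-point. -/
def SimplicialPi (K : SSet.{u}) (n : ℕ) (x : K _⦋0⦌) : Type u :=
  Quot (fun f g : K.PtSimplex n x => Nonempty (SSet.PtSimplex.RelStruct f g (Fin.last n)))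

/-- The class of an `n`-simplex whose boundary is at the base-point. -/
def SimplicialPi.mk {K : SSet.{u}} {n : ℕ} {x : K _⦋0⦌} (f : K.PtSimplex n x) :
    SimplicialPi K n x := Quot.mk _ f

/-- `G` is the usual group structure on the `n`-th simplicial homotopy group, `n ≥ 1`:
`[f] [g] = [k]` exactly when there is an `(n+1)`-simplex `w` with `∂_{n-1} w = f`, `∂_{n+1} w = g`,
`∂_n w = k` and all other faces at the base-point. -/
def IsHomotopyGroup {K : SSet.{u}} {n : ℕ} (hn : 1 ≤ n) {x : K _⦋0⦌}
    (G : Group (SimplicialPi K n x)) : Prop :=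
  ∀ f g k : K.PtSimplex n x,
    G.mul (SimplicialPi.mk f) (SimplicialPi.mk g) = SimplicialPi.mk k ↔
      Nonempty (SSet.PtSimplex.MulStruct g f k ⟨n - 1, by omega⟩)

namespace OmegaCat

/-- The globular simplicial nerve of `C` (its non-augmented part): the simplicial nerve of the
path ω-category. -/
def globularNerve (C : Type u) [OmegaCat C] [NonContracting C] : SSet.{u} :=
  simplicialNerve (PathCat C)

/-- A `1`-morphism of `C` as a vertex of the globular nerve. -/
def basePoint {C : Type u} [OmegaCat C] [NonContracting C] (φ : C) (hφ : HasDim φ 1) :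
    (globularNerve C) _⦋0⦌ :=
  Fun.const (Oriental 0) (PathCat.ofArrow φ hφ) (PathCat.d_ofArrow φ hφ)

/-- The underlying set of `π^{gl}_{n+1}(C, φ) = π_n(N^{gl}(C), φ)`. -/
abbrev GlobularPi (C : Type u) [OmegaCat C] [NonContracting C] (n : ℕ) (φ : C)
    (hφ : HasDim φ 1) : Type u :=
  SimplicialPi (globularNerve C) n (basePoint φ hφ)

/-- The value, in `C`, of a simplex of the globular nerve of `C` at an element of `Δⁿ`. -/
def eval {C : Type u} [OmegaCat C] [NonContracting C] {n : ℕ} {x₀ : (globularNerve C) _⦋0⦌}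
    (x : (globularNerve C).PtSimplex n x₀) (c : Oriental n) : C :=
  (Fun.toFun (A := Oriental n) (B := PathCat C) (SSet.yonedaEquiv x.map) c).1

end OmegaCat

end Nerve

open OmegaCat

/-!
The path ω-category `A = PathCat C` is an ω-groupoid, and the plan is to identify the homotopy
groups of its simplicial nerve with globular ones, for which the statement is the interchange law.

*Orientals are generated by atoms* (`Oriental.atom_induction`). In the chain description of `Δⁿ`
the canonical source and target of a face are given by a parity condition (`Oriental.atomCell`),
and the Gray code of a face increases strictly from source faces to a face to its target faces.
Hence among the summands of an element above dimension `q` one with least Gray code can be split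
off as a first factor for `*_q`, and induction applies. An ω-functor on `Δⁿ` is therefore
determined by its values at the faces. No universal property of `Δⁿ` is needed in the other
direction: all the ω-functors required are written down explicitly.

*Loops.* For a point `p` of `A`, the elements with `k`-source and `k`-target `p` form a group
`Loops p k` under `*_k`, which is commutative for `k ≥ 1` (Eckmann–Hilton), and every composition
`a *_m b` of loops equals `a (t_m a)⁻¹ b` (`Loops.comp_eq`). Since the chain of a composite in
`Δⁿ` is `a + b - t_m a`, a map `Δⁿ → Loops p k` that is multiplicative in the coefficients and
respects sources and targets is an ω-functor (`Loops.mkFun`). In this way a `(k+1)`-simplex with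
constant boundary is the same as its value `u` at the top face, with value a power of `u`
elsewhere, and a `(k+2)`-simplex with faces `x`, `z`, `y` opposite to `k`, `k + 1`, `k + 2` and
other faces constant exists exactly when a `(k+2)`-cell relates `x y` and `z`
(`Loops.exists_comp_map_eq_simplex_iff`). So the simplicial homotopy set is in bijection with a
quotient group `Loops.Pi p k` of `Loops p k`, which carries the group structure.

*Conclusion.* Composition `*_0` in `C` is a homomorphism on loops by interchange, and it commutes
with all higher sources and targets; it therefore descends to the quotients. If `φ *_0 ψ` is
`0`-dimensional, the composites have `1`-source `φ *_0 ψ` and are degenerate because `C` is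
non-contracting.
-/

/-! ### Atoms of the orientals and generation -/

namespace Oriental

open Finset

variable {n : ℕ}

/-- The coefficient of the face `τ` in the `p`-source (`α = false`) or the `p`-target (`α = true`)
of the face `σ`: it is `1` exactly when `τ` is a `p`-dimensional face of `σ` such that the number
of vertices of `τ` below an omitted vertex of `σ` is always even (source) or always odd (target).
For `τ = σ` both conditions are void, so that both coefficients are `1`. -/
def atomCell (σ : Finset (Fin (n + 1))) (α : Bool) (p : ℕ) (τ : Finset (Fin (n + 1))) : ℕ :=
  if τ ⊆ σ ∧ #τ = p + 1 ∧ ∀ v ∈ σ \ τ, (Even #(τ.filter (· < v)) ↔ α = false) then 1 else 0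

/-- The sign count behind the boundary formula for canonical sources and targets. A position `v`
contributes only if the parity `e` is constant below `v` and constant, with the other value, above
`v`. When the parity changes once, in the right direction, the two positions next to the change
contribute with opposite signs; when it never changes, a single extreme position contributes. -/
theorem sum_sign_of_parity_change {ι : Type*} [LinearOrder ι] (D : Finset ι) (e : ι → Prop)
    [DecidablePred e] (α : Bool) :
    (∑ v ∈ D, (if e v then -1 else 1 : ℤ) *
      (if ∀ u ∈ D, (u < v → (e u ↔ α = false)) ∧ (v < u → (e u ↔ α = true)) then 1 else 0)) =
      (if ∀ v ∈ D, ¬ e v then 1 else 0) - (if ∀ v ∈ D, e v then 1 else 0) := by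
  refine Finset.induction_on_max D (by simp) fun m D hm ih => ?_
  · have hmD : m ∉ D := fun h => lt_irrefl _ (hm m h)
    rw [sum_insert hmD]
    have h1 : (∀ u ∈ insert m D, (u < m → (e u ↔ α = false)) ∧ (m < u → (e u ↔ α = true))) ↔
        ∀ u ∈ D, (e u ↔ α = false) := by
      constructor
      · intro h u hu
        exact (h u (mem_insert_of_mem hu)).1 (hm u hu)
      · intro h u hu
        rcases mem_insert.1 hu with rfl | hu
        · exact ⟨fun h => absurd h (lt_irrefl _), fun h => absurd h (lt_irrefl _)⟩
        · exact ⟨fun _ => h u hu, fun h' => absurd h' (hm u hu).asymm⟩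
    have h2 : ∀ v ∈ D, ((∀ u ∈ insert m D,
        (u < v → (e u ↔ α = false)) ∧ (v < u → (e u ↔ α = true))) ↔
        (e m ↔ α = true) ∧ ∀ u ∈ D, (u < v → (e u ↔ α = false)) ∧ (v < u → (e u ↔ α = true))) := by
      intro v hv
      rw [forall_mem_insert]
      refine and_congr ⟨fun h => h.2 (hm v hv), fun h => ⟨fun h' => absurd h' (hm v hv).asymm,
        fun _ => h⟩⟩ Iff.rfl
    rw [sum_congr rfl fun v hv => by rw [if_congr (h2 v hv) rfl rfl], if_congr h1 rfl rfl,
      if_congr (forall_mem_insert (p := fun v => ¬ e v) m D) rfl rfl,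
      if_congr (forall_mem_insert (p := fun v => e v) m D) rfl rfl]
    by_cases hem : e m <;> cases α <;> simp_all <;> split_ifs <;> simp

theorem bdry_atomCell (σ : Finset (Fin (n + 1))) (α : Bool) (p : ℕ) (τ : Finset (Fin (n + 1))) :
    bdry (fun ρ => (atomCell σ α (p + 1) ρ : ℤ)) τ =
      atomCell σ true p τ - atomCell σ false p τ := by
  by_cases hτ : τ ⊆ σ ∧ #τ = p + 1
  · obtain ⟨hs, hc⟩ := hτ
    have key := sum_sign_of_parity_change (σ \ τ) (fun v => Even #(τ.filter (· < v))) α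
    have hR := key.trans (c := (atomCell σ true p τ - atomCell σ false p τ : ℤ))
      (by simp [atomCell, hs, hc])
    rw [← hR, bdry]
    symm
    refine sum_subset_zero_on_sdiff ?_ ?_ ?_
    · intro v hv
      simp only [mem_sdiff] at hv
      simpa using hv.2
    · intro v hv
      simp only [mem_sdiff, mem_compl, not_and, not_not] at hv
      have hvσ : v ∉ σ := fun h => hv.1 (hv.2 h)
      rw [atomCell, if_neg, Nat.cast_zero, mul_zero]
      exact fun h => hvσ (h.1 (mem_insert_self v τ))
    · intro v hv
      simp only [mem_sdiff] at hv
      have hcount : ∀ u, #((insert v τ).filter (· < u)) =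
          #(τ.filter (· < u)) + if v < u then 1 else 0 := by
        intro u
        rw [filter_insert]
        split_ifs with h
        · rw [card_insert_of_notMem (by simp [hv.2])]
        · rfl
      rw [faceSign, atomCell]
      congr 1
      have hiff : (insert v τ ⊆ σ ∧ #(insert v τ) = p + 1 + 1 ∧
          ∀ u ∈ σ \ insert v τ, (Even #((insert v τ).filter (· < u)) ↔ α = false)) ↔
          ∀ u ∈ σ \ τ, (u < v → (Even #(τ.filter (· < u)) ↔ α = false)) ∧
            (v < u → (Even #(τ.filter (· < u)) ↔ α = true)) := by
        rw [card_insert_of_notMem hv.2, hc]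
        simp only [insert_subset_iff, hv.1, hs, true_and]
        symm
        constructor
        · intro h u hu
          simp only [mem_sdiff, mem_insert, not_or] at hu
          rcases lt_trichotomy u v with h1 | h1 | h1
          · rw [hcount, if_neg h1.asymm, add_zero]
            exact (h u (mem_sdiff.2 ⟨hu.1, hu.2.2⟩)).1 h1
          · exact absurd h1 hu.2.1
          · rw [hcount, if_pos h1, Nat.even_add_one,
              (h u (mem_sdiff.2 ⟨hu.1, hu.2.2⟩)).2 h1]
            cases α <;> simp
        · intro h u hu
          simp only [mem_sdiff] at hu
          constructor
          · intro h1
            have := h u (by simp [hu, h1.ne])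
            rwa [hcount, if_neg h1.asymm, add_zero] at this
          · intro h1
            have := h u (by simp [hu, h1.ne'])
            rw [hcount, if_pos h1, Nat.even_add_one] at this
            cases α <;> simp_all
      rw [Nat.cast_ite, Nat.cast_one, Nat.cast_zero]
      by_cases hP : insert v τ ⊆ σ ∧ #(insert v τ) = p + 1 + 1 ∧
          ∀ u ∈ σ \ insert v τ, (Even #((insert v τ).filter (· < u)) ↔ α = false)
      · rw [if_pos hP, if_pos (hiff.1 hP)]
      · rw [if_neg hP, if_neg (mt hiff.2 hP)]
  · have h0 : ∀ β, atomCell σ β p τ = 0 := fun β => if_neg fun h => hτ ⟨h.1, h.2.1⟩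
    rw [h0, h0, bdry, sub_self]
    refine sum_eq_zero fun v hv => ?_
    rw [atomCell, if_neg, Nat.cast_zero, mul_zero]
    rintro ⟨h1, h2, -⟩
    rw [card_insert_of_notMem (by simpa using hv)] at h2
    exact hτ ⟨(subset_insert v τ).trans h1, by omega⟩

theorem sum_atomCell_zero (σ : Finset (Fin (n + 1))) (hσ : σ.Nonempty) (α : Bool) :
    ∑ τ, atomCell σ α 0 τ = 1 := by
  have hone : ∀ w u : Fin (n + 1), #(({w} : Finset (Fin (n + 1))).filter (· < u)) =
      if w < u then 1 else 0 := by
    intro w u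
    rw [filter_singleton]
    split_ifs <;> simp
  -- the extreme vertex: the last one for the source, the first one for the target
  obtain ⟨w, hw, hext⟩ : ∃ w ∈ σ, ∀ u ∈ σ, u ≠ w → (w < u ↔ α = true) := by
    cases α
    · exact ⟨σ.max' hσ, σ.max'_mem hσ, fun u hu _ => by
        simpa only [Bool.false_eq_true, iff_false, not_lt] using σ.le_max' u hu⟩
    · exact ⟨σ.min' hσ, σ.min'_mem hσ, fun u hu h => by
        simpa using lt_of_le_of_ne (σ.min'_le u hu) h.symm⟩
  rw [sum_eq_single {w}]
  · refine if_pos ⟨by simpa using hw, by simp, fun u hu => ?_⟩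
    simp only [mem_sdiff, mem_singleton] at hu
    have h := hext u hu.1 hu.2
    rw [hone]
    split_ifs with h' <;> cases α <;> simp_all
  · intro τ _ hτ
    refine if_neg ?_
    rintro ⟨h1, h2, h3⟩
    obtain ⟨z, rfl⟩ := card_eq_one.1 h2
    have hzσ : z ∈ σ := by simpa using h1
    have hzw : z ≠ w := fun h => hτ (by rw [h])
    have h4 := h3 w (by simp [hw, hzw.symm])
    have h5 := hext z hzσ hzw
    rw [hone] at h4
    rcases lt_or_gt_of_ne hzw with h | h
    · cases α <;> simp_all [h.asymm]
    · cases α <;> simp_all [h.asymm]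
  · simp

/-- The atom of a face `σ` of the `n`-simplex: the free generator `σ` of `Δⁿ`. -/
def atom (σ : Finset (Fin (n + 1))) (hσ : σ.Nonempty) : Oriental n where
  cell := atomCell σ
  card_eq α p τ h := by
    by_contra hc
    exact h (if_neg fun h' => hc h'.2.1)
  sum_zero := sum_atomCell_zero σ hσ
  bdry_succ := bdry_atomCell σ

theorem atomCell_of_card {σ τ : Finset (Fin (n + 1))} {p : ℕ} (hσ : #σ = p + 1) (α : Bool) :
    atomCell σ α p τ = if τ = σ then 1 else 0 := by
  refine if_congr ⟨fun h => eq_of_subset_of_card_le h.1 (by omega), ?_⟩ rfl rfl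
  rintro rfl
  simp [hσ]

theorem atomCell_of_card_lt {σ τ : Finset (Fin (n + 1))} {p : ℕ} (hσ : #σ < p + 1) (α : Bool) :
    atomCell σ α p τ = 0 :=
  if_neg fun h => by have := card_le_card h.1; omega

/-- The Gray code of a face: at the vertex `v`, the parity of the number of vertices of the face up
to `v`. The source faces of `σ` come before `σ` and the target faces after it,
which is what makes the orientals loop-free. -/
def grayCode (σ : Finset (Fin (n + 1))) : Lex (Fin (n + 1) → ℕ) :=
  toLex fun v => #(σ.filter (· ≤ v)) % 2

/-- The Gray codes of a face and of a face of its source or target first differ at the least omitted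
vertex. -/
theorem exists_grayCode_diff {σ τ : Finset (Fin (n + 1))} {p : ℕ} {α : Bool}
    (h : atomCell σ α p τ ≠ 0) (hp : p + 1 < #σ) :
    ∃ v, (∀ u < v, #(τ.filter (· ≤ u)) = #(σ.filter (· ≤ u))) ∧
      #(σ.filter (· ≤ v)) = #(τ.filter (· ≤ v)) + 1 ∧ (Even #(τ.filter (· ≤ v)) ↔ α = false) := by
  have h' : τ ⊆ σ ∧ #τ = p + 1 ∧ ∀ v ∈ σ \ τ, (Even #(τ.filter (· < v)) ↔ α = false) := by
    by_contra hc
    exact h (if_neg hc)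
  obtain ⟨h1, h2, h3⟩ := h'
  have hne : (σ \ τ).Nonempty := by
    rw [← card_pos, card_sdiff_of_subset h1]; omega
  have hv := (σ \ τ).min'_mem hne
  set v := (σ \ τ).min' hne with hvdef
  have hmin : ∀ u < v, u ∈ σ → u ∈ τ := by
    intro u hu hσ
    by_contra hτ
    exact absurd ((σ \ τ).min'_le u (mem_sdiff.2 ⟨hσ, hτ⟩)) (not_le.2 hu)
  have hv' := mem_sdiff.1 hv
  have hlt : τ.filter (· ≤ v) = τ.filter (· < v) := by
    ext u
    simp only [mem_filter, and_congr_right_iff]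
    exact fun hu => ⟨fun h => lt_of_le_of_ne h fun he => hv'.2 (he ▸ hu), le_of_lt⟩
  refine ⟨v, ?_, ?_, ?_⟩
  · intro u hu
    congr 1
    ext z
    simp only [mem_filter, and_congr_left_iff]
    exact fun hz => ⟨fun hh => h1 hh, hmin z (hz.trans_lt hu)⟩
  · have : σ.filter (· ≤ v) = insert v (τ.filter (· ≤ v)) := by
      ext u
      simp only [mem_filter, mem_insert]
      constructor
      · rintro ⟨hu, hle⟩
        rcases hle.eq_or_lt with rfl | hlt
        · exact Or.inl rfl
        · exact Or.inr ⟨hmin u hlt hu, hle⟩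
      · rintro (rfl | ⟨hu, hle⟩)
        · exact ⟨hv'.1, le_rfl⟩
        · exact ⟨h1 hu, hle⟩
    rw [this, card_insert_of_notMem (by simp [hv'.2])]
  · rw [hlt]
    exact h3 v hv

theorem grayCode_lt_of_source {σ τ : Finset (Fin (n + 1))} {p : ℕ}
    (h : atomCell σ false p τ ≠ 0) (hp : p + 1 < #σ) : grayCode τ < grayCode σ := by
  obtain ⟨v, h1, h2, h3⟩ := exists_grayCode_diff h hp
  refine ⟨v, fun u hu => ?_, ?_⟩
  · change #(τ.filter (· ≤ u)) % 2 = #(σ.filter (· ≤ u)) % 2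
    rw [h1 u hu]
  · have h4 : Even #(τ.filter (· ≤ v)) := h3.2 rfl
    rw [Nat.even_iff] at h4
    change #(τ.filter (· ≤ v)) % 2 < #(σ.filter (· ≤ v)) % 2
    omega

theorem grayCode_lt_of_target {σ τ : Finset (Fin (n + 1))} {p : ℕ}
    (h : atomCell σ true p τ ≠ 0) (hp : p + 1 < #σ) : grayCode σ < grayCode τ := by
  obtain ⟨v, h1, h2, h3⟩ := exists_grayCode_diff h hp
  refine ⟨v, fun u hu => ?_, ?_⟩
  · change #(σ.filter (· ≤ u)) % 2 = #(τ.filter (· ≤ u)) % 2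
    rw [h1 u hu]
  · have h4 : ¬ Even #(τ.filter (· ≤ v)) := fun h => by simpa using h3.1 h
    rw [Nat.even_iff] at h4
    change #(σ.filter (· ≤ v)) % 2 < #(τ.filter (· ≤ v)) % 2
    omega

/-- The sum of the chains of the atoms of a multiset of faces. -/
def atomSum (M : Multiset (Finset (Fin (n + 1)))) (α : Bool) (p : ℕ)
    (τ : Finset (Fin (n + 1))) : ℕ :=
  (M.map fun σ => atomCell σ α p τ).sum

@[simp]
theorem atomSum_zero (α : Bool) (p : ℕ) (τ : Finset (Fin (n + 1))) : atomSum 0 α p τ = 0 := rfl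

@[simp]
theorem atomSum_cons (σ : Finset (Fin (n + 1))) (M : Multiset (Finset (Fin (n + 1)))) (α : Bool)
    (p : ℕ) (τ : Finset (Fin (n + 1))) :
    atomSum (σ ::ₘ M) α p τ = atomCell σ α p τ + atomSum M α p τ := by
  simp [atomSum]

theorem bdry_atomSum (M : Multiset (Finset (Fin (n + 1)))) (α : Bool) (p : ℕ)
    (τ : Finset (Fin (n + 1))) :
    bdry (fun ρ => (atomSum M α (p + 1) ρ : ℤ)) τ = atomSum M true p τ - atomSum M false p τ := by
  induction M using Multiset.induction_on with
  | empty => simp [bdry_zero]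
  | cons σ M ih =>
    simp only [atomSum_cons, Nat.cast_add]
    rw [bdry_add, ih, bdry_atomCell]
    ring

/-- Every chain of faces of a fixed dimension is a sum of atoms. -/
theorem exists_atomSum_eq (q : ℕ) (c : Finset (Fin (n + 1)) → ℕ) (hc : ∀ τ, c τ ≠ 0 → #τ = q + 1) :
    ∃ M : Multiset (Finset (Fin (n + 1))), (∀ σ ∈ M, #σ = q + 1) ∧
      ∀ α τ, atomSum M α q τ = c τ := by
  refine ⟨∑ σ, Multiset.replicate (c σ) σ, ?_, ?_⟩
  · intro σ hσ
    obtain ⟨ρ, -, hρ⟩ := Multiset.mem_sum.1 hσ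
    rw [Multiset.mem_replicate] at hρ
    rw [hρ.2]
    exact hc ρ hρ.1
  · intro α τ
    have : ∀ s : Finset (Finset (Fin (n + 1))),
        atomSum (∑ σ ∈ s, Multiset.replicate (c σ) σ) α q τ = ∑ σ ∈ s, c σ * atomCell σ α q τ := by
      intro s
      induction s using Finset.induction_on with
      | empty => simp
      | insert a s ha ih =>
        rw [sum_insert ha, sum_insert ha, ← ih]
        simp [atomSum]
    rw [this, sum_eq_single τ]
    · by_cases h : c τ = 0
      · simp [h]
      · rw [atomCell_of_card (hc τ h)]; simp
    · intro σ _ hσ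
      by_cases h : c σ = 0
      · simp [h]
      · rw [atomCell_of_card (hc σ h), if_neg hσ.symm, mul_zero]
    · simp

theorem atomSum_of_card_lt {M : Multiset (Finset (Fin (n + 1)))} {p : ℕ}
    (hM : ∀ σ ∈ M, #σ < p + 1) (α : Bool) (τ : Finset (Fin (n + 1))) : atomSum M α p τ = 0 := by
  refine Multiset.sum_eq_zero fun k hk => ?_
  obtain ⟨σ, hσ, rfl⟩ := Multiset.mem_map.1 hk
  exact atomCell_of_card_lt (hM σ hσ) α

/-- A face minimal for the Gray code can be split off: its source lies in the source of `x`,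
because it meets the target of no other summand. -/
theorem atomCell_le_cell {q : ℕ} {e : Finset (Fin (n + 1))} {M : Multiset (Finset (Fin (n + 1)))}
    {x : Oriental n} (hx : ∀ α τ, x.cell α (q + 1) τ = atomSum (e ::ₘ M) α (q + 1) τ)
    (hM : ∀ σ ∈ e ::ₘ M, q + 2 ≤ #σ) (hmin : ∀ σ ∈ e ::ₘ M, ¬ grayCode σ < grayCode e)
    (τ : Finset (Fin (n + 1))) : atomCell e false q τ ≤ x.cell false q τ := by
  by_cases h0 : atomCell e false q τ = 0
  · omega
  · have h1 := x.bdry_succ false q τ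
    simp only [hx] at h1
    rw [bdry_atomSum] at h1
    have h2 : atomSum (e ::ₘ M) true q τ = 0 := by
      refine Multiset.sum_eq_zero fun k hk => ?_
      obtain ⟨σ, hσ, rfl⟩ := Multiset.mem_map.1 hk
      by_contra hne
      exact hmin σ hσ ((grayCode_lt_of_target hne (hM σ hσ)).trans
        (grayCode_lt_of_source h0 (hM e (Multiset.mem_cons_self e M))))
    rw [h2, atomSum_cons] at h1
    omega

/-- If the part of `x` above dimension `q` is a nonempty sum of atoms, then an atom minimal for the
Gray code gives the first factor of a decomposition of `x` for `*_q`. -/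
theorem exists_comp_of_minimal {q : ℕ} {e : Finset (Fin (n + 1))}
    {M : Multiset (Finset (Fin (n + 1)))} {x : Oriental n}
    (hx : ∀ α p, q + 1 ≤ p → ∀ τ, x.cell α p τ = atomSum (e ::ₘ M) α p τ)
    (hM : ∀ σ ∈ e ::ₘ M, q + 2 ≤ #σ) (hmin : ∀ σ ∈ e ::ₘ M, ¬ grayCode σ < grayCode e) :
    ∃ (y z : Oriental n) (h : d true q y = d false q z), x = comp q y z h ∧
      (∀ α p, q + 1 ≤ p → ∀ τ, y.cell α p τ = atomSum {e} α p τ) ∧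
      (∀ α p, q + 1 ≤ p → ∀ τ, z.cell α p τ = atomSum M α p τ) := by
  have hle := atomCell_le_cell (fun α τ => hx α (q + 1) le_rfl τ) hM hmin
  have hene : e.Nonempty := by
    rw [← card_pos]; have := hM e (Multiset.mem_cons_self e M); omega
  -- the common face of the two factors in dimension `q`
  let mid : Finset (Fin (n + 1)) → ℕ := fun τ =>
    x.cell false q τ - atomCell e false q τ + atomCell e true q τ
  have hmid : ∀ τ, (mid τ : ℤ) =
      x.cell false q τ + (atomCell e true q τ - atomCell e false q τ) := by
    intro τ
    have := hle τ
    simp only [mid]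
    omega
  have hmid_card : ∀ τ, mid τ ≠ 0 → #τ = q + 1 := by
    intro τ h
    by_cases h1 : x.cell false q τ = 0
    · have h2 : atomCell e true q τ ≠ 0 := by
        simp only [mid] at h; omega
      exact (atom e hene).card_eq true q τ h2
    · exact x.card_eq false q τ h1
  have hmid_bdry : ∀ r, q = r + 1 → ∀ τ, bdry (fun ρ => (mid ρ : ℤ)) τ =
      x.cell true r τ - x.cell false r τ := by
    rintro r rfl τ
    have h1 : (fun ρ => (mid ρ : ℤ)) = fun ρ => (x.cell false (r + 1) ρ : ℤ) +
        ((fun ρ => (atomCell e true (r + 1) ρ : ℤ)) ρ -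
          (fun ρ => (atomCell e false (r + 1) ρ : ℤ)) ρ) :=
      funext hmid
    rw [h1, bdry_add, x.bdry_succ]
    have h2 : bdry (fun ρ => ((fun ρ => (atomCell e true (r + 1) ρ : ℤ)) ρ -
        (fun ρ => (atomCell e false (r + 1) ρ : ℤ)) ρ)) τ =
        bdry (fun ρ => (atomCell e true (r + 1) ρ : ℤ)) τ -
        bdry (fun ρ => (atomCell e false (r + 1) ρ : ℤ)) τ := by
      simp only [bdry, mul_sub, sum_sub_distrib]
    rw [h2, bdry_atomCell, bdry_atomCell]
    ring
  have hmid_sum : q = 0 → ∑ τ, mid τ = 1 := by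
    rintro rfl
    have h1 := x.sum_zero false
    have h2 := sum_atomCell_zero e hene true
    have h3 := sum_atomCell_zero e hene false
    have : (∑ τ, (mid τ : ℤ)) = 1 := by
      simp only [hmid, sum_add_distrib, sum_sub_distrib]
      rw [← Nat.cast_sum, ← Nat.cast_sum, ← Nat.cast_sum, h1, h2, h3]
      norm_num
    exact_mod_cast this
  let y : Oriental n :=
    { cell := fun β p => if p < q then x.cell β p else if p = q then
        (if β then mid else x.cell false q) else atomCell e β p
      card_eq := by
        intro β p σ h
        split_ifs at h with h1 h2 h3
        · exact x.card_eq _ _ _ h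
        · rw [h2]; exact hmid_card σ h
        · rw [h2]; exact x.card_eq _ _ _ h
        · exact (atom e hene).card_eq β p σ h
      sum_zero := by
        intro β
        rcases Nat.eq_zero_or_pos q with h | h
        · subst h
          cases β
          · simpa using x.sum_zero false
          · simpa using hmid_sum rfl
        · simpa [h] using x.sum_zero β
      bdry_succ := by
        intro β p τ
        rcases lt_trichotomy (p + 1) q with h1 | h1 | h1
        · simpa [h1, show p < q by omega] using x.bdry_succ β p τ
        · subst h1
          cases β
          · simpa using x.bdry_succ false p τ
          · simpa using hmid_bdry p rfl τ
        · rcases (show p = q ∨ q < p by omega) with rfl | h2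
          · simpa [hmid] using bdry_atomCell e β p τ
          · simpa [show ¬ p + 1 < q by omega, show ¬ p + 1 = q by omega, show ¬ p < q by omega,
              h2.ne'] using bdry_atomCell e β p τ }
  let z : Oriental n :=
    { cell := fun β p => if p < q then x.cell β p else if p = q then
        (if β then x.cell true q else mid) else atomSum M β p
      card_eq := by
        intro β p σ h
        split_ifs at h with h1 h2 h3
        · exact x.card_eq _ _ _ h
        · rw [h2]; exact x.card_eq _ _ _ h
        · rw [h2]; exact hmid_card σ h
        · refine x.card_eq β p σ ?_
          rw [hx β p (by omega), atomSum_cons]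
          omega
      sum_zero := by
        intro β
        rcases Nat.eq_zero_or_pos q with h | h
        · subst h
          cases β
          · simpa using hmid_sum rfl
          · simpa using x.sum_zero true
        · simpa [h] using x.sum_zero β
      bdry_succ := by
        intro β p τ
        rcases lt_trichotomy (p + 1) q with h1 | h1 | h1
        · simpa [h1, show p < q by omega] using x.bdry_succ β p τ
        · subst h1
          cases β
          · simpa using hmid_bdry p rfl τ
          · simpa using x.bdry_succ true p τ
        · rcases (show p = q ∨ q < p by omega) with rfl | h2
          · have h3 := x.bdry_succ β p τ
            simp only [hx β (p + 1) le_rfl] at h3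
            rw [bdry_atomSum, atomSum_cons, atomSum_cons] at h3
            have h4 := bdry_atomSum M β p τ
            simp only [show ¬ p + 1 < p by omega, show ¬ p + 1 = p by omega, lt_irrefl, if_false,
              if_true, hmid, h4, Bool.false_eq_true]
            push_cast at h3
            linarith
          · simpa [show ¬ p + 1 < q by omega, show ¬ p + 1 = q by omega, show ¬ p < q by omega,
              h2.ne'] using bdry_atomSum M β p τ }
  have h : d true q y = d false q z := by
    ext β p τ
    change (face true q y).cell β p τ = (face false q z).cell β p τ
    simp only [face, y, z]
    split_ifs <;> first | rfl | omega | simp_all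
  refine ⟨y, z, h, ?_, ?_, ?_⟩
  · ext β p τ
    change x.cell β p τ = (compose q y z h).cell β p τ
    simp only [compose, y, z]
    split_ifs with h1 h2 h3
    · rfl
    · subst h2; subst h3; simp
    · subst h2; simp_all
    · rw [hx β p (by omega), atomSum_cons]
  · intro α p hp τ
    simp [y, show ¬ p < q by omega, show ¬ p = q by omega, atomSum]
  · intro α p hp τ
    simp [z, show ¬ p < q by omega, show ¬ p = q by omega]

/-- Every element of `Δⁿ` is obtained from atoms by composition. The induction is on the dimension
`q` above which the element is a sum of atoms, then on the number of summands. -/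
theorem atom_induction {P : Oriental n → Prop} (hatom : ∀ σ hσ, P (atom σ hσ))
    (hcomp : ∀ m a b h, P a → P b → P (comp m a b h)) (x : Oriental n) : P x := by
  have main : ∀ q : ℕ, ∀ (M : Multiset (Finset (Fin (n + 1)))) (x : Oriental n),
      (∀ σ ∈ M, q + 1 ≤ #σ) → (∀ α p, q ≤ p → ∀ τ, x.cell α p τ = atomSum M α p τ) → P x := by
    intro q
    induction q with
    | zero =>
      intro M x hM hx
      have hone : M.card = 1 := by
        have h1 := x.sum_zero false
        simp only [hx false 0 le_rfl] at h1
        refine Eq.trans ?_ h1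
        clear h1 hx
        induction M using Multiset.induction_on with
        | empty => simp
        | cons σ M ih =>
          simp only [atomSum_cons, sum_add_distrib, Multiset.card_cons]
          rw [sum_atomCell_zero σ (card_pos.1 (hM σ (Multiset.mem_cons_self σ M))),
            ← ih fun ρ hρ => hM ρ (Multiset.mem_cons_of_mem hρ)]
          ring
      obtain ⟨σ, rfl⟩ := Multiset.card_eq_one.1 hone
      have hσ : σ.Nonempty := card_pos.1 (hM σ (Multiset.mem_singleton_self σ))
      have : x = atom σ hσ := by
        ext α p τ
        rw [hx α p (Nat.zero_le p)]
        simp [atomSum, atom]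
      rw [this]
      exact hatom σ hσ
    | succ q ihq =>
      -- at most one summand: refine the decomposition to dimension `q`
      have small : ∀ (M : Multiset (Finset (Fin (n + 1)))) (x : Oriental n),
          (∀ σ ∈ M, q + 2 ≤ #σ) →
          (∀ α p, q + 1 ≤ p → ∀ τ, x.cell α p τ = atomSum M α p τ) →
          (∀ τ, atomSum M false q τ ≤ x.cell false q τ) → P x := by
        intro M x hM hx hle
        obtain ⟨C, hC1, hC2⟩ := exists_atomSum_eq q
          (fun τ => x.cell false q τ - atomSum M false q τ)
          (fun τ h => x.card_eq false q τ (by omega))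
        refine ihq (M + C) x ?_ ?_
        · intro σ hσ
          rcases Multiset.mem_add.1 hσ with h | h
          · have := hM σ h; omega
          · exact (hC1 σ h).ge
        · intro α p hp τ
          have hadd : atomSum (M + C) α p τ = atomSum M α p τ + atomSum C α p τ := by
            simp [atomSum]
          rw [hadd]
          rcases hp.eq_or_lt with rfl | hp
          · have h1 := x.bdry_succ false q τ
            simp only [hx false (q + 1) le_rfl] at h1
            rw [bdry_atomSum] at h1
            have h2 := hle τ
            rw [hC2]
            cases α <;> omega
          · rw [hx α p hp, atomSum_of_card_lt (M := C), add_zero]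
            intro σ hσ
            have := hC1 σ hσ; omega
      intro M
      induction hk : M.card generalizing M with
      | zero =>
        intro x hM hx
        obtain rfl := Multiset.card_eq_zero.1 hk
        exact small 0 x (by simp) hx (by simp)
      | succ k ihk =>
        intro x hM hx
        obtain ⟨e, he, hmin⟩ : ∃ e ∈ M, ∀ σ ∈ M, ¬ grayCode σ < grayCode e := by
          have hne : M.toFinset.Nonempty := by
            rw [Multiset.toFinset_nonempty]
            rintro rfl
            simp at hk
          obtain ⟨e, he, h⟩ := M.toFinset.exists_min_image grayCode hne
          exact ⟨e, by simpa using he, fun σ hσ => not_lt.2 (h σ (by simpa using hσ))⟩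
        obtain ⟨M', rfl⟩ := Multiset.exists_cons_of_mem he
        obtain ⟨y, z, h, rfl, hy, hz⟩ := exists_comp_of_minimal hx hM hmin
        refine hcomp q y z h ?_ ?_
        · have he' : ∀ σ ∈ ({e} : Multiset (Finset (Fin (n + 1)))), q + 2 ≤ #σ := by
            intro σ hσ
            rw [Multiset.mem_singleton.1 hσ]
            exact hM e (Multiset.mem_cons_self e M')
          refine small {e} y he' hy fun τ => ?_
          have := atomCell_le_cell (M := 0) (fun α τ => hy α (q + 1) le_rfl τ) he'
            (fun σ hσ => by rw [Multiset.mem_singleton.1 hσ]; exact lt_irrefl _) τ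
          simpa [atomSum] using this
        · exact ihk M' (by simpa using hk) z
            (fun σ hσ => hM σ (Multiset.mem_cons_of_mem hσ)) hz
  refine main (n + 1) 0 x (by simp) fun α p hp τ => ?_
  by_contra hne
  have h1 := x.card_eq α p τ (by simpa using hne)
  have h2 := card_le_univ τ
  simp only [Fintype.card_fin] at h2
  omega

theorem fun_ext_atom {A : Type u} [OmegaCat A] {F F' : Fun (Oriental n) A}
    (h : ∀ σ hσ, F (atom σ hσ) = F' (atom σ hσ)) : F = F' := by
  refine Fun.ext' (atom_induction h fun m a b hab ha hb => ?_)
  have h1 : d true m (F a) = d false m (F b) := by rw [← F.map_d, ← F.map_d, hab]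
  have h2 : d true m (F' a) = d false m (F' b) := by rw [← F'.map_d, ← F'.map_d, hab]
  rw [F.map_comp m a b hab h1, F'.map_comp m a b hab h2]
  exact comp_congr ha hb _ _

theorem map_atom {m : ℕ} (f : Fin (m + 1) →o Fin (n + 1)) (hf : StrictMono f)
    (σ : Finset (Fin (m + 1))) (hσ : σ.Nonempty) :
    map f (atom σ hσ) = atom (σ.image f) (hσ.image f) := by
  ext α p τ
  change push f (atomCell σ α p) τ = atomCell (σ.image f) α p τ
  by_cases hτ : τ ⊆ σ.image f
  · obtain ⟨ρ, hρ, rfl⟩ := subset_image_iff.1 hτ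
    have hcard : #(ρ.image f) = #ρ := card_image_of_injective ρ hf.injective
    rw [push, sum_eq_single ρ]
    · rw [if_pos ⟨rfl, hcard.symm⟩]
      refine if_congr ?_ rfl rfl
      rw [hcard, ← image_sdiff _ _ hf.injective, forall_mem_image,
        image_subset_image_iff hf.injective]
      refine and_congr_right fun _ => and_congr_right fun _ => forall₂_congr fun v _ => ?_
      rw [filter_image, card_image_of_injective _ hf.injective]
      simp only [hf.lt_iff_lt]
    · intro ρ' _ hne
      exact if_neg fun h => hne (image_injective hf.injective h.1)
    · simp
  · rw [atomCell, if_neg fun h => hτ h.1]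
    refine sum_eq_zero fun ρ _ => ?_
    split_ifs with h
    · refine if_neg fun h' => hτ ?_
      rw [← h.1]
      exact image_subset_image h'.1
    · rfl

end Oriental

/-! ### Groups of loops in an ω-groupoid -/

namespace OmegaCat

theorem comp_eq_left {A : Type u} [OmegaCat A] {m : ℕ} {a b : A} (h : d true m a = d false m b)
    (hb : b = d true m a) : comp m a b h = a :=
  (comp_congr rfl hb h (d_d_of_le _ _ _ _ _ le_rfl).symm).trans (comp_tgt m a _)

theorem comp_eq_right {A : Type u} [OmegaCat A] {m : ℕ} {a b : A} (h : d true m a = d false m b)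
    (ha : a = d false m b) : comp m a b h = b :=
  (comp_congr ha rfl h (d_d_of_le _ _ _ _ _ le_rfl)).trans (src_comp m b _)

/-- The elements of dimension `0`, as possible base points. -/
abbrev Point (A : Type u) [OmegaCat A] : Type u := {b : A // ∀ α, d α 0 b = b}

theorem Point.d_eq {A : Type u} [OmegaCat A] (p : Point A) (α : Bool) (m : ℕ) : d α m p.1 = p.1 :=
  d_of_d_zero p.2 α m

/-- The elements of arbitrary dimension whose `k`-source and `k`-target are the base point. -/
def Loops {A : Type u} [OmegaCat A] (p : Point A) (k : ℕ) : Type u :=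
  {a : A // ∀ α, d α k a = p.1}

namespace Loops

variable {A : Type u} [OmegaCat A] {p : Point A} {k : ℕ}

theorem d_eq_of_le (a : Loops p k) (α : Bool) {m : ℕ} (hm : m ≤ k) : d α m a.1 = p.1 := by
  rcases hm.eq_or_lt with rfl | hm
  · exact a.2 α
  · rw [← d_d_of_lt α α m k a.1 hm, a.2, p.d_eq]

theorem composable (a b : Loops p k) : d true k a.1 = d false k b.1 :=
  (a.2 true).trans (b.2 false).symm

instance : Mul (Loops p k) where
  mul a b := ⟨comp k a.1 b.1 (composable a b), by
    rintro (_ | _)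
    · exact (src_of_comp _ _ _ _).trans (a.2 false)
    · exact (tgt_of_comp _ _ _ _).trans (b.2 true)⟩

instance : One (Loops p k) where
  one := ⟨p.1, fun α => p.d_eq α k⟩

variable [IsOmegaGroupoid A]

theorem exists_left_inv (a : Loops p k) : ∃ b : Loops p k, b * a = 1 := by
  obtain ⟨y, h₁, h₂, -, h⟩ := IsOmegaGroupoid.exists_inv k a.1
  refine ⟨⟨y, ?_⟩, Subtype.ext (h.trans (a.2 true))⟩
  rintro (_ | _)
  · exact h₁.symm.trans (a.2 true)
  · exact h₂.trans (a.2 false)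

noncomputable instance : Inv (Loops p k) where
  inv a := (exists_left_inv a).choose

/-- The loops at a point of an ω-groupoid form a group under the composition `*_k`. -/
noncomputable instance : Group (Loops p k) :=
  Group.ofLeftAxioms (fun a b c => Subtype.ext (assoc k a.1 b.1 c.1 _ _ _ _))
    (fun a => Subtype.ext (comp_eq_right _ (a.2 false).symm))
    (fun a => (exists_left_inv a).choose_spec)

/-- The `m`-source and the `m`-target are endomorphisms of the group of loops; for `m ≤ k` they
are trivial. -/
def face (α : Bool) (m : ℕ) : Loops p k →* Loops p k where
  toFun a := ⟨d α m a.1, by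
    intro β
    rcases le_or_gt m k with h | h
    · rw [d_eq_of_le a α h, p.d_eq]
    · rw [d_d_of_lt _ _ _ _ _ h, a.2]⟩
  map_one' := Subtype.ext (p.d_eq α m)
  map_mul' a b := by
    refine Subtype.ext ?_
    rcases eq_or_ne m k with rfl | h
    · have h1 : ∀ c : Loops p m, d α m c.1 = p.1 := fun c => c.2 α
      change d α m (a * b).1 = comp m (d α m a.1) (d α m b.1) _
      rw [h1]
      exact ((comp_congr (h1 a) (h1 b) _ (by rw [p.d_eq, p.d_eq])).trans
        (comp_eq_left _ (p.d_eq _ _).symm)).symm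
    · exact d_comp α m k a.1 b.1 h _ _

theorem face_of_le (α : Bool) {m : ℕ} (hm : m ≤ k) (a : Loops p k) : face α m a = 1 :=
  Subtype.ext (d_eq_of_le a α hm)

theorem face_face (α β : Bool) (m : ℕ) (a : Loops p k) : face β m (face α m a) = face α m a :=
  Subtype.ext (d_d_of_le β α m m a.1 le_rfl)

/-- The Eckmann–Hilton argument: below dimension `k` all compositions of loops agree with `*_k`
and with its opposite. -/
theorem comp_of_lt {m : ℕ} (hm : m < k) (a b : Loops p k) (h : d true m a.1 = d false m b.1) :
    comp m a.1 b.1 h = (a * b).1 ∧ comp m a.1 b.1 h = (b * a).1 := by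
  have hp : ∀ (c : Loops p k) α, d α m c.1 = p.1 := fun c α => d_eq_of_le c α hm.le
  have key : ∀ (x y z w : Loops p k),
      comp m (x * y).1 (z * w).1 ((hp _ _).trans (hp _ _).symm) =
      comp k (comp m x.1 z.1 ((hp _ _).trans (hp _ _).symm))
        (comp m y.1 w.1 ((hp _ _).trans (hp _ _).symm)) (by
          rw [d_comp true k m _ _ hm.ne' _ (by simp only [x.2, z.2, p.d_eq]),
            d_comp false k m _ _ hm.ne' _ (by simp only [y.2, w.2, p.d_eq])]
          exact comp_congr ((x.2 _).trans (y.2 _).symm) ((z.2 _).trans (w.2 _).symm) _ _) :=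
    fun x y z w => interchange m k x.1 y.1 z.1 w.1 hm.ne _ _ _ _ _ _
  constructor
  · have := key a 1 1 b
    simp only [mul_one, one_mul] at this
    rw [this]
    exact comp_congr (comp_eq_left _ (hp _ _).symm) (comp_eq_right _ (hp _ _).symm) _ _
  · have := key 1 a b 1
    simp only [mul_one, one_mul] at this
    rw [this]
    exact comp_congr (comp_eq_right _ (hp _ _).symm) (comp_eq_left _ (hp _ _).symm) _ _

theorem mul_comm_of_pos (hk : 0 < k) (a b : Loops p k) : a * b = b * a :=
  have h := comp_of_lt hk a b ((d_eq_of_le a _ hk.le).trans (d_eq_of_le b _ hk.le).symm)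
  Subtype.ext (h.1.symm.trans h.2)

/-- In a group object all compositions are determined by the group law. -/
theorem comp_eq (m : ℕ) (a b : Loops p k) (h : d true m a.1 = d false m b.1) :
    comp m a.1 b.1 h = (a * (face true m a)⁻¹ * b).1 := by
  rcases lt_trichotomy m k with hm | rfl | hm
  · rw [face_of_le _ hm.le, inv_one, mul_one]
    exact (comp_of_lt hm a b h).1
  · rw [face_of_le _ le_rfl, inv_one, mul_one]
    rfl
  · have hst : face true m a = face false m b := Subtype.ext h
    set c : Loops p k := (face true m a)⁻¹ * b with hc
    have hc1 : face false m c = 1 := by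
      rw [hc, map_mul, map_inv, face_face, hst, inv_mul_cancel]
    have hb : b = face true m a * c := by rw [hc, mul_inv_cancel_left]
    have h1 : d true m a.1 = d false m (face true m a).1 :=
      (d_d_of_le _ _ _ _ _ le_rfl).symm
    have h2 : d true m (1 : Loops p k).1 = d false m c.1 :=
      (p.d_eq _ _).trans (congrArg Subtype.val hc1).symm
    have h3 : comp m a.1 (face true m a).1 h1 = a.1 := comp_eq_left _ rfl
    have h4 : comp m (1 : Loops p k).1 c.1 h2 = c.1 :=
      comp_eq_right _ (congrArg Subtype.val hc1).symm
    have key := interchange m k a.1 (1 : Loops p k).1 (face true m a).1 c.1 hm.ne'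
      (composable _ _) (composable _ _) (by
        change d true m (a * 1).1 = d false m (face true m a * c).1
        rw [mul_one, ← hb, h]) h1 h2 (by rw [h3, h4]; exact composable _ _)
    rw [mul_assoc, ← hc]
    refine (comp_congr ?_ ?_ _ _).trans (key.trans (comp_congr h3 h4 _ _))
    · exact congrArg Subtype.val (mul_one a).symm
    · exact congrArg Subtype.val hb

/-- A map to a group of loops that commutes with sources and targets and turns the chain
`a + b - t_m a` of a composite `a *_m b` into a product is an ω-functor. -/
def mkFun {B : Type v} [OmegaCat B] (Φ : B → Loops p k)
    (hd : ∀ α m c, Φ (d α m c) = face α m (Φ c))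
    (hcomp : ∀ m a b h, Φ (comp m a b h) = Φ a * (Φ (d true m a))⁻¹ * Φ b) : Fun B A where
  toFun c := (Φ c).1
  map_d α m c := congrArg Subtype.val (hd α m c)
  map_comp m a b h h' := by
    rw [comp_eq, hcomp, hd]

theorem mkFun_apply {B : Type v} [OmegaCat B] (Φ : B → Loops p k)
    (hd : ∀ α m c, Φ (d α m c) = face α m (Φ c))
    (hcomp : ∀ m a b h, Φ (comp m a b h) = Φ a * (Φ (d true m a))⁻¹ * Φ b) (c : B) :
    mkFun Φ hd hcomp c = (Φ c).1 := rfl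

/-- The loops whose `(k+1)`-source bounds, i.e. is the target of a loop with trivial source. -/
def bounding (p : Point A) (k : ℕ) : Subgroup (Loops p k) where
  carrier := {a | ∃ c, face false (k + 1) c = 1 ∧ face true (k + 1) c = face false (k + 1) a}
  one_mem' := ⟨1, map_one _, by rw [map_one, map_one]⟩
  mul_mem' := by
    rintro a b ⟨c, hc, hc'⟩ ⟨e, he, he'⟩
    exact ⟨c * e, by rw [map_mul, hc, he, one_mul], by rw [map_mul, map_mul, hc', he']⟩
  inv_mem' := by
    rintro a ⟨c, hc, hc'⟩
    exact ⟨c⁻¹, by rw [map_inv, hc, inv_one], by rw [map_inv, map_inv, hc']⟩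

theorem mem_bounding {a : Loops p k} : a ∈ bounding p k ↔
    ∃ c, face false (k + 1) c = 1 ∧ face true (k + 1) c = face false (k + 1) a := Iff.rfl

instance : (bounding p k).Normal where
  conj_mem := by
    rintro a ⟨c, hc, hc'⟩ g
    refine ⟨face false (k + 1) g * c * (face false (k + 1) g)⁻¹, ?_, ?_⟩
    · rw [map_mul, map_mul, hc, mul_one, map_inv, mul_inv_cancel]
    · simp only [map_mul, map_inv, hc', face_face]

theorem face_mem_bounding (a : Loops p k) : a⁻¹ * face false (k + 1) a ∈ bounding p k :=
  ⟨1, map_one _, by rw [map_mul, map_inv, face_face, inv_mul_cancel, map_one]⟩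

/-- The `(k+1)`-st homotopy group of an ω-groupoid, in globular terms: the `(k+1)`-cells whose
boundary is the base point, under `*_k`, up to `(k+2)`-cells. It is obtained from the group of all
loops, where a loop represents the same class as its `(k+1)`-source. -/
abbrev Pi (p : Point A) (k : ℕ) : Type u := Loops p k ⧸ bounding p k

end Loops

end OmegaCat

/-! ### Simplices of the nerve in terms of loops -/

namespace Oriental

open Finset

variable {n : ℕ}

theorem cell_d (α β : Bool) (m p : ℕ) (x : Oriental n) : (d α m x).cell β p =
    if p < m then x.cell β p else if p = m then x.cell α p else fun _ => 0 := rfl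

theorem cell_comp (β : Bool) (m p : ℕ) (a b : Oriental n) (h : d true m a = d false m b) :
    (comp m a b h).cell β p = if p < m then a.cell β p else if p = m then
    (if β then b.cell β p else a.cell β p) else fun σ => a.cell β p σ + b.cell β p σ := rfl

/-- A composite `a *_m b` is the sum `a + b - t_m a`, at the level of chains. -/
theorem cell_comp_add (m p : ℕ) (a b : Oriental n) (h : d true m a = d false m b)
    (τ : Finset (Fin (n + 1))) : (comp m a b h).cell false p τ + (d true m a).cell false p τ =
      a.cell false p τ + b.cell false p τ := by
  rw [cell_comp, cell_d]
  rcases lt_trichotomy p m with h1 | rfl | h1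
  · simp [h1, cell_eq_of_lt h false h1]
  · simp [cell_eq h]
  · simp [h1.not_gt, h1.ne']

/-- In the top dimension there is no difference between source and target. -/
theorem cell_top (x : Oriental n) (α : Bool) (τ : Finset (Fin (n + 1))) :
    x.cell α n τ = x.cell false n τ := by
  have h0 : ∀ σ, x.cell false (n + 1) σ = 0 := by
    intro σ
    by_contra hne
    have h1 := x.card_eq _ _ _ hne
    have h2 := card_le_univ σ
    simp only [Fintype.card_fin] at h2
    omega
  have := x.bdry_succ false n τ
  simp only [h0, Nat.cast_zero, bdry_zero] at this
  cases α
  · rfl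
  · omega

/-- The elements that do not contain a given top-dimensional face are closed under factors. -/
theorem top_eq_zero_of_comp (m : ℕ) (a b : Oriental n) (h : d true m a = d false m b)
    {τ : Finset (Fin (n + 1))} (h0 : (comp m a b h).cell false n τ = 0) :
    a.cell false n τ = 0 ∧ b.cell false n τ = 0 := by
  have h1 := cell_comp_add m n a b h τ
  have h2 : (d true m a).cell false n τ = 0 ∨ (d true m a).cell false n τ = a.cell false n τ := by
    rw [cell_d]
    split_ifs with h3 h4
    · exact Or.inr rfl
    · exact Or.inr (cell_top a true τ)
    · exact Or.inl rfl
  have h3 : (comp m a b h).cell false n τ = a.cell false n τ ∨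
      (comp m a b h).cell false n τ = a.cell false n τ + b.cell false n τ := by
    rw [cell_comp]
    split_ifs with h4 h5 h6
    · exact Or.inl rfl
    · exact h6.elim
    · exact Or.inl rfl
    · exact Or.inr rfl
  omega

theorem card_filter_compl_lt (i : Fin (n + 1)) :
    #((({i} : Finset (Fin (n + 1)))ᶜ).filter (· < i)) = i := by
  have : (({i} : Finset (Fin (n + 1)))ᶜ).filter (· < i) = Iio i := by
    ext u
    simp only [mem_filter, mem_compl, mem_singleton, mem_Iio, and_iff_right_iff_imp]
    exact ne_of_lt
  rw [this, Fin.card_Iio]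

/-- The boundary of the top face, in the codimension-one face opposite to the vertex `i`. -/
theorem cell_compl_sub (x : Oriental (n + 1)) (i : Fin (n + 2)) :
    (x.cell true n {i}ᶜ : ℤ) - x.cell false n {i}ᶜ =
      -(-1) ^ (i : ℕ) * x.cell false (n + 1) univ := by
  rw [← x.bdry_succ false n, bdry, compl_compl, sum_singleton, faceSign, card_filter_compl_lt]
  have : insert i ({i}ᶜ : Finset (Fin (n + 2))) = univ := by
    ext u; simp
  rw [this]
  split_ifs with h
  · rw [h.neg_one_pow]
  · rw [(Nat.not_even_iff_odd.1 h).neg_one_pow, neg_neg]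

theorem atomCell_univ_compl (α : Bool) (i : Fin (n + 2)) :
    atomCell univ α n {i}ᶜ = if (Even (i : ℕ) ↔ α = false) then 1 else 0 := by
  refine if_congr ?_ rfl rfl
  simp [card_compl, card_filter_compl_lt]

/-- The atom of a proper face `σ` comes from the codimension-one face opposite to some vertex `j`.
-/
theorem exists_map_succAbove_eq_atom {σ : Finset (Fin (n + 2))}
    (hσ : σ.Nonempty) (h : σ ≠ univ) : ∃ (j : Fin (n + 2)) (τ : Finset (Fin (n + 1)))
      (hτ : τ.Nonempty), Oriental.map (Fin.succAboveOrderEmb j).toOrderHom (atom τ hτ) = atom σ hσ ∧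
      j ∉ σ ∧ (σ = {j}ᶜ ↔ τ = univ) := by
  obtain ⟨j, hj⟩ : ∃ j, j ∉ σ := by
    by_contra! hc
    exact h (eq_univ_of_forall hc)
  have himage : (univ.filter fun i => j.succAbove i ∈ σ).image j.succAbove = σ := by
    ext u
    simp only [mem_image, mem_filter, mem_univ, true_and]
    constructor
    · rintro ⟨i, hi, rfl⟩
      exact hi
    · intro hu
      obtain ⟨i, rfl⟩ := Fin.exists_succAbove_eq (show u ≠ j from fun h => hj (h ▸ hu))
      exact ⟨i, hu, rfl⟩
  refine ⟨j, univ.filter fun i => j.succAbove i ∈ σ, ?_, ?_, hj, ?_⟩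
  · rw [← himage] at hσ
    exact image_nonempty.1 hσ
  · rw [map_atom _ (Fin.strictMono_succAbove j)]
    congr 1
  · constructor
    · rintro rfl
      simp
    · intro h'
      rw [← himage, h']
      ext u
      simp

end Oriental

namespace OmegaCat.Loops

open Oriental Finset

variable {A : Type u} [OmegaCat A] {p : Point A} {k : ℕ} [IsOmegaGroupoid A]

theorem face_eq_of_le {a : Loops p k} {r m : ℕ} (ha : face false r a = a) (hm : r ≤ m) (α : Bool) :
    face α m a = a := by
  rw [← ha]
  exact Subtype.ext (d_d_of_le α false m r a.1 hm)

/-- The `(k+1)`-simplex with constant boundary and with value `u` at the top face: its value at an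
element of `Δ^{k+1}` is a power of `u`. -/
noncomputable def simplex (u : Loops p k) (hu : face false (k + 1) u = u) :
    Fun (Oriental (k + 1)) A :=
  mkFun (fun c => u ^ c.cell false (k + 1) univ)
    (by
      intro α m c
      rw [map_pow, cell_d]
      rcases lt_trichotomy (k + 1) m with h | rfl | h
      · rw [if_pos h, face_eq_of_le hu h.le]
      · rw [if_neg (lt_irrefl _), if_pos rfl, face_eq_of_le hu le_rfl, cell_top]
      · rw [if_neg h.not_gt, if_neg h.ne', face_of_le α (by omega), one_pow, pow_zero])
    (by
      intro m a b h
      have := cell_comp_add m (k + 1) a b h univ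
      simp only [← zpow_natCast, ← zpow_neg, ← zpow_add]
      congr 1
      omega)

theorem simplex_apply (u : Loops p k) (hu : face false (k + 1) u = u) (c : Oriental (k + 1)) :
    simplex u hu c = (u ^ c.cell false (k + 1) univ).1 := rfl

theorem simplex_atom_univ (u : Loops p k) (hu : face false (k + 1) u = u) :
    simplex u hu (atom univ univ_nonempty) = u.1 := by
  rw [simplex_apply]
  change (u ^ atomCell univ false (k + 1) univ).1 = _
  rw [atomCell_of_card (by simp), if_pos rfl, pow_one]

theorem simplex_atom_of_ne (u : Loops p k) (hu : face false (k + 1) u = u)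
    {σ : Finset (Fin (k + 2))} (hσ : σ.Nonempty) (h : σ ≠ univ) :
    simplex u hu (atom σ hσ) = p.1 := by
  rw [simplex_apply]
  change (u ^ atomCell σ false (k + 1) univ).1 = _
  rw [atomCell, if_neg fun h' => h (univ_subset_iff.1 h'.1), pow_zero]
  rfl

/-- A simplex with constant boundary is determined by its value at the top face. -/
theorem exists_eq_simplex (x : Fun (Oriental (k + 1)) A)
    (hx : ∀ σ hσ, σ ≠ univ → x (atom σ hσ) = p.1) : ∃ u hu, x = simplex (p := p) (k := k) u hu := by
  have hlow : ∀ c : Oriental (k + 1), c.cell false (k + 1) univ = 0 → x c = p.1 := by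
    refine atom_induction (fun σ hσ h => hx σ hσ ?_) fun m a b h ha hb h0 => ?_
    · rintro rfl
      change atomCell univ false (k + 1) univ = 0 at h
      rw [atomCell_of_card (by simp), if_pos rfl] at h
      exact one_ne_zero h
    · have hab := top_eq_zero_of_comp m a b h h0
      have h' : d true m (x a) = d false m (x b) := by rw [← x.map_d, ← x.map_d, h]
      rw [x.map_comp m a b h h']
      exact (comp_eq_left h' (by rw [ha hab.1, hb hab.2, p.d_eq])).trans (ha hab.1)
  have hu1 : ∀ α, d α k (x (atom univ univ_nonempty)) = p.1 := by
    intro α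
    rw [← x.map_d]
    refine hlow _ ?_
    rw [cell_d]
    simp
  let u : Loops p k := ⟨x (atom univ univ_nonempty), hu1⟩
  refine ⟨u, Subtype.ext ?_, fun_ext_atom fun σ hσ => ?_⟩
  · change d false (k + 1) (x (atom univ univ_nonempty)) = x (atom univ univ_nonempty)
    rw [← x.map_d]
    congr 1
    ext β q τ
    rw [cell_d]
    split_ifs with h1 h2
    · rfl
    · subst h2
      rw [cell_top _ β]
    · symm
      refine if_neg fun h => ?_
      have h3 := card_le_univ τ
      rw [h.2.1, Fintype.card_fin] at h3
      omega
  · by_cases h : σ = univ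
    · subst h
      exact (simplex_atom_univ u _).symm
    · exact (hx σ hσ h).trans (simplex_atom_of_ne u _ hσ h).symm

theorem comm_zpow_combination {G : Type*} [Group G] (hG : ∀ a b : G, a * b = b * a) (v x y z : G)
    (K₁ K₂ K₃ a₁ a₂ a₃ b₁ b₂ b₃ c₁ c₂ c₃ : ℤ) :
    v ^ (K₁ + K₂ - K₃) * x ^ (a₁ + a₂ - a₃) * y ^ (b₁ + b₂ - b₃) * z ^ (c₁ + c₂ - c₃) =
      v ^ K₁ * x ^ a₁ * y ^ b₁ * z ^ c₁ * (v ^ K₃ * x ^ a₃ * y ^ b₃ * z ^ c₃)⁻¹ *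
        (v ^ K₂ * x ^ a₂ * y ^ b₂ * z ^ c₂) := by
  let _ : CommGroup G := { ‹Group G› with mul_comm := hG }
  have h : ∀ {B : Type _} [AddCommGroup B] (v x y z : B),
      (K₁ + K₂ - K₃) • v + (a₁ + a₂ - a₃) • x + (b₁ + b₂ - b₃) • y + (c₁ + c₂ - c₃) • z =
      K₁ • v + a₁ • x + b₁ • y + c₁ • z + -(K₃ • v + a₃ • x + b₃ • y + c₃ • z) +
        (K₂ • v + a₂ • x + b₂ • y + c₂ • z) := by
    intro B _ v x y z
    module
  exact h (B := Additive G) (Additive.ofMul v) (Additive.ofMul x) (Additive.ofMul y)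
    (Additive.ofMul z)

theorem comm_zpow_boundary {G : Type*} [Group G] (hG : ∀ a b : G, a * b = b * a) (x y z : G)
    (ε K a b c : ℤ) :
    ((z * (x * y)⁻¹) ^ ε) ^ K * x ^ a * y ^ b * z ^ c =
      x ^ (-ε * K + a) * y ^ (-ε * K + b) * z ^ (ε * K + c) := by
  let _ : CommGroup G := { ‹Group G› with mul_comm := hG }
  have h : ∀ {B : Type _} [AddCommGroup B] (x y z : B),
      K • (ε • (z + -(x + y))) + a • x + b • y + c • z =
      (-ε * K + a) • x + (-ε * K + b) • y + (ε * K + c) • z := by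
    intro B _ x y z
    module
  exact h (B := Additive G) (Additive.ofMul x) (Additive.ofMul y) (Additive.ofMul z)

/-- A candidate for the values of a `(k+2)`-simplex whose faces opposite to the vertices `k`,
`k + 1`, `k + 2` are `x`, `z`, `y` and whose other faces are constant; `v` records the value at the
top face, translated so that its source is trivial. -/
noncomputable def value (x y z v : Loops p k) (c : Oriental (k + 2)) : Loops p k :=
  v ^ c.cell false (k + 2) univ * x ^ c.cell false (k + 1) {(Fin.last k).castSucc.castSucc}ᶜ *
    y ^ c.cell false (k + 1) {(Fin.last k).succ.succ}ᶜ *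
    z ^ c.cell false (k + 1) {(Fin.last k).castSucc.succ}ᶜ

/-- The constraints on the coefficients of an element of `Δ²`: the edges form a path between two
vertices, edges being directed towards the smaller vertex. -/
theorem cell_two (c : Oriental 2) (α : Bool) :
    (c.cell false 0 {2} = c.cell true 0 {2} + c.cell α 1 {0}ᶜ + c.cell α 1 {1}ᶜ ∧
    c.cell true 0 {0} = c.cell false 0 {0} + c.cell α 1 {1}ᶜ + c.cell α 1 {2}ᶜ ∧
    c.cell true 0 {1} + c.cell α 1 {2}ᶜ = c.cell false 0 {1} + c.cell α 1 {0}ᶜ) ∧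
    c.cell α 0 {0} + c.cell α 0 {1} + c.cell α 0 {2} = 1 := by
  have h0 := c.bdry_succ α 0 {0}
  have h1 := c.bdry_succ α 0 {1}
  have h2 := c.bdry_succ α 0 {2}
  have hs : c.cell α 0 {0} + c.cell α 0 {1} + c.cell α 0 {2} = 1 := by
    refine Eq.trans ?_ (c.sum_zero α)
    have : ∑ σ ∈ ({{0}, {1}, {2}} : Finset (Finset (Fin 3))), c.cell α 0 σ =
        ∑ σ, c.cell α 0 σ := by
      refine sum_subset (subset_univ _) fun σ _ hσ => ?_
      by_contra hne
      obtain ⟨u, rfl⟩ := card_eq_one.1 (c.card_eq α 0 σ hne)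
      fin_cases u <;> simp at hσ
    rw [← this, sum_insert (by decide), sum_insert (by decide), sum_singleton, add_assoc]
  have e0 : ({0} : Finset (Fin 3))ᶜ = {1, 2} := by decide
  have e1 : ({1} : Finset (Fin 3))ᶜ = {0, 2} := by decide
  have e2 : ({2} : Finset (Fin 3))ᶜ = {0, 1} := by decide
  have f1 : ({2, 1} : Finset (Fin 3)) = {1, 2} := by decide
  have f2 : ({2, 0} : Finset (Fin 3)) = {0, 2} := by decide
  have f3 : ({1, 0} : Finset (Fin 3)) = {0, 1} := by decide
  have hsign : ∀ i j : Fin 3, faceSign {i} j = if i < j then 1 else -1 := by decide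
  simp only [bdry, e0, e1, e2, zero_add] at h0 h1 h2 ⊢
  rw [sum_pair (by decide)] at h0 h1 h2
  simp only [hsign, f1, f2, f3] at h0 h1 h2
  rw [if_pos (by decide), if_pos (by decide)] at h0
  rw [if_neg (by decide), if_pos (by decide)] at h1
  rw [if_neg (by decide), if_neg (by decide)] at h2
  exact ⟨by omega, hs⟩

/-- The effect of the top face of `Δ²` on the edges: it goes from `{1,2} + {0,1}` to `{0,2}`. -/
theorem cell_two_top (c : Oriental 2) :
    c.cell false 1 {0}ᶜ = c.cell true 1 {0}ᶜ + c.cell false 2 univ ∧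
    c.cell false 1 {2}ᶜ = c.cell true 1 {2}ᶜ + c.cell false 2 univ ∧
    c.cell true 1 {1}ᶜ = c.cell false 1 {1}ᶜ + c.cell false 2 univ := by
  have h0 := cell_compl_sub c 0
  have h1 := cell_compl_sub c 1
  have h2 := cell_compl_sub c 2
  norm_num at h0 h1 h2
  omega

theorem value_zero (x y z v : Loops p 0) (c : Oriental 2) : value x y z v c =
    v ^ c.cell false 2 univ * x ^ c.cell false 1 {0}ᶜ * y ^ c.cell false 1 {2}ᶜ *
      z ^ c.cell false 1 {1}ᶜ := rfl

/-- `value` turns the chain of a composite into a product. For `k ≥ 1` the group is commutative; for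
`k = 0` the order of the factors is that of the path `2 → 1 → 0` in `Δ²`. -/
theorem value_comp (x y z v : Loops p k) (m : ℕ) (a b : Oriental (k + 2))
    (h : d true m a = d false m b) : value x y z v (comp m a b h) =
      value x y z v a * (value x y z v (d true m a))⁻¹ * value x y z v b := by
  rcases Nat.eq_zero_or_pos k with rfl | hk
  · rcases (show m = 0 ∨ m = 1 ∨ 2 ≤ m by omega) with rfl | rfl | hm
    · -- one of the factors is constant, or `a` is the edge opposite to `0` and `b` the edge
      -- opposite to `2`
      have ha := cell_two a false
      have ha' := cell_two a true
      have ha'' := cell_two_top a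
      have hb := cell_two b false
      have hb' := cell_two b true
      have hb'' := cell_two_top b
      have hab := cell_eq h
      simp only [hab] at ha ha'
      have hval : ∀ c : Oriental 2, value x y z v (d true 0 c) = 1 := by
        intro c
        simp [value_zero, cell_d]
      rw [hval, inv_one, mul_one, value_zero, value_zero, value_zero]
      simp only [cell_comp, if_false, Nat.not_lt_zero, one_ne_zero,
        OfNat.ofNat_ne_zero]
      rcases (show (a.cell false 2 univ = 0 ∧ a.cell false 1 {0}ᶜ = 0 ∧ a.cell false 1 {2}ᶜ = 0 ∧
          a.cell false 1 {1}ᶜ = 0) ∨ (b.cell false 2 univ = 0 ∧ b.cell false 1 {0}ᶜ = 0 ∧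
          b.cell false 1 {2}ᶜ = 0 ∧ b.cell false 1 {1}ᶜ = 0) ∨
          (a.cell false 2 univ = 0 ∧ a.cell false 1 {2}ᶜ = 0 ∧ a.cell false 1 {1}ᶜ = 0 ∧
          b.cell false 2 univ = 0 ∧ b.cell false 1 {0}ᶜ = 0 ∧ b.cell false 1 {1}ᶜ = 0) by omega)
        with h' | h' | h' <;> simp [h']
    · -- the factors cannot both contain the `2`-cell
      have ha := cell_two_top a
      have ha' := cell_two a false
      have ha'' := cell_two a true
      have hb := cell_two_top b
      have hb' := cell_two b false
      have hab := cell_eq h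
      simp only [value_zero, cell_comp, cell_d, lt_irrefl, if_false, if_true, Bool.false_eq_true,
        show ¬ (2 : ℕ) < 1 by omega, show ¬ (2 : ℕ) = 1 by omega, pow_zero, one_mul, hab]
      simp only [hab] at ha ha''
      rcases (show b.cell false 2 univ = 0 ∨ a.cell false 2 univ = 0 by omega) with h' | h'
      · simp [h', mul_assoc]
      · rw [h', add_zero] at ha
        simp [h', ha, mul_assoc]
    · have e1 : value x y z v (comp m a b h) = value x y z v a := by
        simp only [value_zero, cell_comp, show 1 < m by omega, if_true]
        rcases hm.eq_or_lt with rfl | hm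
        · simp
        · simp [hm]
      have e2 : value x y z v (d true m a) = value x y z v a := by
        simp only [value_zero, cell_d, show 1 < m by omega, if_true]
        rcases hm.eq_or_lt with rfl | hm
        · simp [cell_top a true]
        · simp [hm]
      have e3 : value x y z v b = value x y z v (d true m a) := by
        rw [h]
        simp only [value_zero, cell_d, show 1 < m by omega, if_true]
        rcases hm.eq_or_lt with rfl | hm
        · simp
        · simp [hm]
      rw [e1, e3, e2, mul_inv_cancel, one_mul]
  · have e : ∀ q τ, ((comp m a b h).cell false q τ : ℤ) =
        a.cell false q τ + b.cell false q τ - (d true m a).cell false q τ := by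
      intro q τ
      have := cell_comp_add m q a b h τ
      omega
    simp only [value, ← zpow_natCast, e]
    exact comm_zpow_combination (mul_comm_of_pos hk) _ _ _ _ _ _ _ _ _ _ _ _ _ _ _ _

/-- `value` is compatible with sources and targets when the target of `v` is the discrepancy between
`x y` and `z`, inverted for odd `k`, where the faces `k` and `k + 2` lie in the target of the top
face instead of its source. -/
theorem value_d (x y z v : Loops p k) (hx : face false (k + 1) x = x)
    (hy : face false (k + 1) y = y) (hz : face false (k + 1) z = z)
    (hv : face false (k + 2) v = v) (hv' : face false (k + 1) v = 1)
    (α : Bool) (m : ℕ) (c : Oriental (k + 2))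
    (hc : c.cell false (k + 2) univ = 0 ∨
      face true (k + 1) v = (z * (x * y)⁻¹) ^ ((-1 : ℤ) ^ k)) :
    value x y z v (d α m c) = face α m (value x y z v c) := by
  simp only [value, map_mul, map_pow]
  rcases (show m ≤ k ∨ m = k + 1 ∨ k + 2 ≤ m by omega) with hm | rfl | hm
  · simp [cell_d, face_of_le α hm, show ¬ k + 2 < m by omega, show ¬ k + 2 = m by omega,
      show ¬ k + 1 < m by omega, show ¬ k + 1 = m by omega]
  · simp only [cell_d, lt_irrefl, if_false, if_true, show ¬ k + 2 < k + 1 by omega,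
      show ¬ k + 2 = k + 1 by omega, pow_zero, one_mul, face_eq_of_le hx le_rfl,
      face_eq_of_le hy le_rfl, face_eq_of_le hz le_rfl]
    cases α
    · rw [hv', one_pow, one_mul]
    · have h0 := cell_compl_sub c (Fin.last k).castSucc.castSucc
      have h1 := cell_compl_sub c (Fin.last k).castSucc.succ
      have h2 := cell_compl_sub c (Fin.last k).succ.succ
      simp only [Fin.val_castSucc, Fin.val_last, Fin.val_succ, pow_succ] at h0 h1 h2
      rcases hc with hc | hc
      · rw [hc]
        simp only [hc, Nat.cast_zero, mul_zero, sub_eq_zero, Nat.cast_inj] at h0 h1 h2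
        rw [h0, h1, h2, pow_zero, one_mul]
      · rw [hc]
        rcases Nat.eq_zero_or_pos k with rfl | hk
        · have h4 := cell_two c false
          have h5 := cell_two c true
          have h6 := cell_two_top c
          symm
          change (_ ^ c.cell false 2 univ) * x ^ c.cell false 1 {0}ᶜ * y ^ c.cell false 1 {2}ᶜ *
            z ^ c.cell false 1 {1}ᶜ = x ^ c.cell true 1 {0}ᶜ * y ^ c.cell true 1 {2}ᶜ *
            z ^ c.cell true 1 {1}ᶜ
          rcases (show c.cell false 2 univ = 0 ∨ (c.cell false 2 univ = 1 ∧
            c.cell false 1 {0}ᶜ = 1 ∧ c.cell false 1 {2}ᶜ = 1 ∧ c.cell false 1 {1}ᶜ = 0) by omega)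
            with h' | ⟨h', h7, h8, h9⟩
          · simp [h6, h']
          · rw [h', h7] at h6
            rw [h8, h9] at h6
            rw [h', h7, h8, h9, h6.2.2, show c.cell true 1 {0}ᶜ = 0 by omega,
              show c.cell true 1 {2}ᶜ = 0 by omega]
            simp [mul_assoc]
        · rw [sub_eq_iff_eq_add] at h0 h1 h2
          simp only [← zpow_natCast, h0, h1, h2]
          rw [comm_zpow_boundary (mul_comm_of_pos hk)]
          simp
  · simp only [face_eq_of_le hx (show k + 1 ≤ m by omega), face_eq_of_le hv hm,
      face_eq_of_le hy (show k + 1 ≤ m by omega), face_eq_of_le hz (show k + 1 ≤ m by omega),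
      cell_d, show k + 1 < m by omega, if_true]
    rcases hm.eq_or_lt with rfl | hm
    · simp [cell_top c α]
    · simp [hm]

/-- The values at the codimension-one faces in `value`. -/
noncomputable def faceValue (x y z : Loops p k) (j : Fin (k + 3)) : Loops p k :=
  if j = (Fin.last k).castSucc.castSucc then x else if j = (Fin.last k).castSucc.succ then z else
    if j = (Fin.last k).succ.succ then y else 1

theorem face_faceValue {x y z : Loops p k} (hx : face false (k + 1) x = x)
    (hy : face false (k + 1) y = y) (hz : face false (k + 1) z = z) (j : Fin (k + 3)) :
    face false (k + 1) (faceValue x y z j) = faceValue x y z j := by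
  rw [faceValue]
  split_ifs
  · exact hx
  · exact hz
  · exact hy
  · exact map_one _

theorem value_atom (x y z v : Loops p k) {σ : Finset (Fin (k + 3))} (hσ : σ.Nonempty)
    (h : σ ≠ univ) (j : Fin (k + 3)) (hj : j ∉ σ) : value x y z v (atom σ hσ) =
      if σ = {j}ᶜ then faceValue x y z j else 1 := by
  have h0 : (atom σ hσ).cell false (k + 2) univ = 0 :=
    if_neg fun h' => h (univ_subset_iff.1 h'.1)
  have h1 : ∀ i : Fin (k + 3), (atom σ hσ).cell false (k + 1) {i}ᶜ =
      if σ = {j}ᶜ ∧ j = i then 1 else 0 := by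
    intro i
    split_ifs with h'
    · obtain ⟨rfl, rfl⟩ := h'
      refine (atomCell_of_card ?_ _).trans (if_pos rfl)
      simp [card_compl]
    · refine if_neg fun h2 => h' ?_
      have h3 : i = j := by
        by_contra hne
        exact hj (h2.1 (by simpa using fun h => hne h.symm))
      subst h3
      refine ⟨subset_antisymm (fun u hu => ?_) h2.1, rfl⟩
      simp only [mem_compl, mem_singleton]
      rintro rfl
      exact hj hu
  rw [value, h0, h1, h1, h1, faceValue]
  have n1 : (Fin.last k).castSucc.castSucc ≠ (Fin.last k).castSucc.succ :=
    fun h => by simp [Fin.ext_iff] at h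
  have n2 : (Fin.last k).castSucc.castSucc ≠ (Fin.last k).succ.succ :=
    fun h => by simp [Fin.ext_iff] at h; omega
  have n3 : (Fin.last k).castSucc.succ ≠ (Fin.last k).succ.succ :=
    fun h => by simp [Fin.ext_iff] at h
  by_cases hs : σ = {j}ᶜ
  · simp only [hs, true_and, if_true, pow_zero, one_mul]
    by_cases j0 : j = (Fin.last k).castSucc.castSucc
    · rw [if_pos j0, if_neg (j0 ▸ n2), if_neg (j0 ▸ n1), if_pos j0]; simp
    by_cases j1 : j = (Fin.last k).castSucc.succ
    · rw [if_neg j0, if_neg (j1 ▸ n3), if_pos j1, if_neg j0, if_pos j1]; simp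
    by_cases j2 : j = (Fin.last k).succ.succ
    · rw [if_neg j0, if_pos j2, if_neg j1, if_neg j0, if_neg j1, if_pos j2]; simp
    · rw [if_neg j0, if_neg j2, if_neg j1, if_neg j0, if_neg j1, if_neg j2]; simp
  · simp [hs]

/-- The values on the proper faces of a `(k+2)`-simplex with the prescribed codimension-one
faces. -/
theorem comp_map_eq_simplex_iff {x y z : Loops p k} (hx : face false (k + 1) x = x)
    (hy : face false (k + 1) y = y) (hz : face false (k + 1) z = z)
    (w : Fun (Oriental (k + 2)) A) :
    (∀ j, w.comp (Oriental.map (Fin.succAboveOrderEmb j).toOrderHom) =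
      simplex (faceValue x y z j) (face_faceValue hx hy hz j)) ↔
    ∀ σ hσ, σ ≠ univ → w (atom σ hσ) = (value x y z 1 (atom σ hσ)).1 := by
  constructor
  · intro h σ hσ hne
    obtain ⟨j, τ, hτ, h1, h2, h3⟩ := exists_map_succAbove_eq_atom hσ hne
    rw [value_atom x y z 1 hσ hne j h2, ← h1]
    have h4 : w (Oriental.map (Fin.succAboveOrderEmb j).toOrderHom (atom τ hτ)) =
        simplex (faceValue x y z j) (face_faceValue hx hy hz j) (atom τ hτ) := by
      rw [← h j]
      rfl
    rw [h4]
    by_cases hτu : τ = univ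
    · subst hτu
      rw [if_pos (h3.2 rfl)]
      exact simplex_atom_univ _ _
    · rw [if_neg (mt h3.1 hτu)]
      exact simplex_atom_of_ne _ _ hτ hτu
  · intro h j
    refine fun_ext_atom fun τ hτ => ?_
    change w (Oriental.map (Fin.succAboveOrderEmb j).toOrderHom (atom τ hτ)) = _
    have hj : j ∉ τ.image j.succAbove := by simp [Fin.succAbove_ne]
    have hne : τ.image j.succAbove ≠ univ := fun h => hj (h ▸ mem_univ j)
    rw [map_atom _ (Fin.strictMono_succAbove j)]
    refine (h _ _ hne).trans ((congrArg Subtype.val (value_atom x y z 1 _ hne j hj)).trans ?_)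
    by_cases hτu : τ = univ
    · subst hτu
      rw [if_pos, simplex_atom_univ]
      ext u
      simp
    · rw [if_neg, simplex_atom_of_ne _ _ hτ hτu]
      · rfl
      · intro hc
        refine hτu (eq_univ_of_forall fun i => ?_)
        have : j.succAbove i ∈ τ.image j.succAbove := by
          rw [hc]; simp [Fin.succAbove_ne]
        obtain ⟨i', hi', he⟩ := mem_image.1 this
        rwa [← Fin.succAbove_right_injective he]

/-- On the elements that do not contain the top face, a `(k+2)`-simplex is given by `value`. -/
theorem eq_value_of_top_eq_zero {x y z : Loops p k} (hx : face false (k + 1) x = x)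
    (hy : face false (k + 1) y = y) (hz : face false (k + 1) z = z)
    (w : Fun (Oriental (k + 2)) A)
    (hw : ∀ σ hσ, σ ≠ univ → w (atom σ hσ) = (value x y z 1 (atom σ hσ)).1) :
    ∀ c : Oriental (k + 2), c.cell false (k + 2) univ = 0 → w c = (value x y z 1 c).1 := by
  refine atom_induction (fun σ hσ h => hw σ hσ ?_) fun m a b h ha hb h0 => ?_
  · rintro rfl
    change atomCell univ false (k + 2) univ = 0 at h
    rw [atomCell_of_card (by simp), if_pos rfl] at h
    exact one_ne_zero h
  · have hab := top_eq_zero_of_comp m a b h h0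
    have h' : d true m (w a) = d false m (w b) := by rw [← w.map_d, ← w.map_d, h]
    have hd := value_d x y z 1 hx hy hz (map_one _) (map_one _) true m a (Or.inl hab.1)
    rw [w.map_comp m a b h h', value_comp, hd, ← comp_eq m _ _ (by
      rw [← ha hab.1, ← hb hab.2, h'])]
    exact comp_congr (ha hab.1) (hb hab.2) _ _

theorem mk_mul_mk_eq_iff {x y z : Loops p k} (hx : face false (k + 1) x = x)
    (hy : face false (k + 1) y = y) (hz : face false (k + 1) z = z) :
    (x : Pi p k) * y = z ↔
      ∃ c : Loops p k, face false (k + 1) c = 1 ∧ face true (k + 1) c = (x * y)⁻¹ * z := by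
  rw [← QuotientGroup.mk_mul, QuotientGroup.eq, mem_bounding]
  simp only [map_mul, map_inv, hx, hy, hz]

/-- A `(k+2)`-simplex with faces `x`, `z`, `y` opposite to the vertices `k`, `k + 1`, `k + 2` and
other faces constant exists if and only if `x y` and `z` represent the same homotopy class. -/
theorem exists_comp_map_eq_simplex_iff {x y z : Loops p k} (hx : face false (k + 1) x = x)
    (hy : face false (k + 1) y = y) (hz : face false (k + 1) z = z) :
    (∃ w : Fun (Oriental (k + 2)) A, ∀ j,
      w.comp (Oriental.map (Fin.succAboveOrderEmb j).toOrderHom) =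
        simplex (faceValue x y z j) (face_faceValue hx hy hz j)) ↔ (x : Pi p k) * y = z := by
  simp only [comp_map_eq_simplex_iff hx hy hz]
  rw [mk_mul_mk_eq_iff hx hy hz]
  constructor
  · rintro ⟨w, hw⟩
    have hlow := eq_value_of_top_eq_zero hx hy hz w hw
    have hW : ∀ α, d α (k + 1) (w (atom univ univ_nonempty)) =
        (value x y z 1 (d α (k + 1) (atom univ univ_nonempty))).1 := by
      intro α
      rw [← w.map_d]
      refine hlow _ ?_
      rw [cell_d]
      simp
    let W : Loops p k := ⟨w (atom univ univ_nonempty), fun α => by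
      rw [← d_d_of_lt α α k (k + 1) _ (Nat.lt_succ_self k), hW]
      exact (value x y z 1 _).2 α⟩
    have hWf : ∀ α, face α (k + 1) W = value x y z 1 (d α (k + 1) (atom univ univ_nonempty)) :=
      fun α => Subtype.ext (hW α)
    have hval : ∀ α, value x y z 1 (d α (k + 1) (atom univ univ_nonempty)) =
        if (Even k ↔ α = false) then x * y else z := by
      intro α
      have hc : ∀ i, (d α (k + 1) (atom (univ : Finset (Fin (k + 3))) univ_nonempty)).cell false
          (k + 1) {i}ᶜ = if (Even (i : ℕ) ↔ α = false) then 1 else 0 := by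
        intro i
        rw [cell_d, if_neg (lt_irrefl _), if_pos rfl]
        exact atomCell_univ_compl α i
      rw [value, hc, hc, hc]
      simp only [Fin.val_castSucc, Fin.val_last, Fin.val_succ, Nat.even_add_one, not_not, one_pow,
        one_mul]
      by_cases hk : Even k <;> cases α <;> simp [hk]
    by_cases hk : Even k
    · refine ⟨(x * y)⁻¹ * W, ?_, ?_⟩ <;>
        rw [map_mul, map_inv, map_mul, hWf, hval, face_eq_of_le hx le_rfl,
          face_eq_of_le hy le_rfl] <;> simp [hk]
    · refine ⟨W⁻¹ * z, ?_, ?_⟩ <;>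
        rw [map_mul, map_inv, hWf, hval, face_eq_of_le hz le_rfl] <;> simp [hk]
  · rintro ⟨c, hc, hc'⟩
    -- conjugation turns `(x y)⁻¹ z` into `z (x y)⁻¹`, and truncation makes `v` a `(k+2)`-cell
    set v : Loops p k := face false (k + 2) ((x * y * c * (x * y)⁻¹) ^ ((-1 : ℤ) ^ k)) with hv
    have hface : ∀ α, face α (k + 1) v =
        (x * y * face α (k + 1) c * (x * y)⁻¹) ^ ((-1 : ℤ) ^ k) := by
      intro α
      have h1 : face α (k + 1) v = face α (k + 1) ((x * y * c * (x * y)⁻¹) ^ ((-1 : ℤ) ^ k)) :=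
        Subtype.ext (d_d_of_lt α false (k + 1) (k + 2) _ (Nat.lt_succ_self _))
      rw [h1, map_zpow, map_mul, map_mul, map_inv, map_mul, face_eq_of_le hx le_rfl,
        face_eq_of_le hy le_rfl]
    have hv0 : face false (k + 1) v = 1 := by
      rw [hface, hc, mul_one, mul_inv_cancel, one_zpow]
    have hv1 : face true (k + 1) v = (z * (x * y)⁻¹) ^ ((-1 : ℤ) ^ k) := by
      rw [hface, hc', mul_inv_cancel_left]
    refine ⟨mkFun (value x y z v) (fun α m e => value_d x y z v hx hy hz (face_face _ _ _ _) hv0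
      α m e (Or.inr hv1)) (value_comp x y z v), fun σ hσ hne => ?_⟩
    obtain ⟨j, hj⟩ : ∃ j, j ∉ σ := by
      by_contra! hc
      exact hne (eq_univ_of_forall hc)
    rw [mkFun_apply, value_atom x y z v hσ hne j hj, value_atom x y z 1 hσ hne j hj]

end OmegaCat.Loops

/-! ### Homotopy groups of the nerve -/

namespace OmegaCat

open CategoryTheory Simplicial

section Nerve

variable {A : Type u} [OmegaCat A]

/-- A point of `A`, as a vertex of the simplicial nerve. -/
abbrev Point.vertex (p : Point A) : (simplicialNerve A) _⦋0⦌ := Fun.const (Oriental 0) p.1 p.2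

/-- The ω-functor `Δⁿ → A` that corresponds to a simplex of the nerve of `A`. -/
def toFunctor {n : ℕ} (g : Δ[n] ⟶ simplicialNerve A) : Fun (Oriental n) A := SSet.yonedaEquiv g

theorem toFunctor_injective {n : ℕ} :
    Function.Injective (toFunctor : (Δ[n] ⟶ simplicialNerve A) → Fun (Oriental n) A) :=
  SSet.yonedaEquiv.injective

theorem toFunctor_surjective {n : ℕ} :
    Function.Surjective (toFunctor : (Δ[n] ⟶ simplicialNerve A) → Fun (Oriental n) A) :=
  SSet.yonedaEquiv.surjective

theorem toFunctor_δ {n : ℕ} (g : Δ[n + 1] ⟶ simplicialNerve A) (j : Fin (n + 2)) :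
    toFunctor (SSet.stdSimplex.δ j ≫ g) =
      (toFunctor g).comp (Oriental.map (Fin.succAboveOrderEmb j).toOrderHom) :=
  SSet.stdSimplex.yonedaEquiv_δ_comp g j

theorem toFunctor_const (p : Point A) (n : ℕ) :
    toFunctor (SSet.const p.vertex : Δ[n] ⟶ simplicialNerve A) = Fun.const _ p.1 p.2 :=
  rfl

end Nerve

namespace Loops

open Oriental Finset

variable {A : Type u} [OmegaCat A] {p : Point A} {k : ℕ}

theorem exists_ptSimplex (F : Fun (Oriental (k + 1)) A)
    (hF : ∀ σ hσ, σ ≠ univ → F (atom σ hσ) = p.1) :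
    ∃ f : (simplicialNerve A).PtSimplex (k + 1) p.vertex, toFunctor f.map = F := by
  obtain ⟨g, rfl⟩ := toFunctor_surjective F
  refine ⟨⟨g, SSet.boundary.hom_ext fun j => ?_⟩, rfl⟩
  rw [SSet.boundary.ι_ι_assoc]
  change _ = SSet.const p.vertex
  refine toFunctor_injective ?_
  rw [toFunctor_δ, toFunctor_const]
  refine fun_ext_atom fun τ hτ => ?_
  change toFunctor g (Oriental.map (Fin.succAboveOrderEmb j).toOrderHom (atom τ hτ)) = p.1
  rw [map_atom _ (Fin.strictMono_succAbove j)]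
  refine hF _ _ fun h => ?_
  have : j ∈ τ.image j.succAbove := by
    change τ.image j.succAbove = univ at h
    rw [h]; exact mem_univ j
  simp [Fin.succAbove_ne] at this

variable [IsOmegaGroupoid A]

theorem simplex_one : simplex (1 : Loops p k) (map_one _) = Fun.const _ p.1 p.2 :=
  Fun.ext' fun c => by rw [simplex_apply, one_pow]; rfl

theorem simplex_injective {u u' : Loops p k} {hu : face false (k + 1) u = u}
    {hu' : face false (k + 1) u' = u'} (h : simplex u hu = simplex u' hu') : u = u' := by
  refine Subtype.ext ?_
  rw [← simplex_atom_univ u hu, h, simplex_atom_univ]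

theorem exists_toFunctor_eq_simplex (f : (simplicialNerve A).PtSimplex (k + 1) p.vertex) :
    ∃ (u : Loops p k) (hu : face false (k + 1) u = u), toFunctor f.map = simplex u hu := by
  refine exists_eq_simplex _ fun σ hσ h => ?_
  obtain ⟨j, τ, hτ, h1, -⟩ := exists_map_succAbove_eq_atom hσ h
  have h2 := toFunctor_δ f.map j
  rw [SSet.PtSimplex.δ_map, toFunctor_const] at h2
  rw [← h1]
  exact (congrArg (fun F => F.toFun (atom τ hτ)) h2).symm

/-- The value at the top face of a simplex with constant boundary. -/
noncomputable def topCell (f : (simplicialNerve A).PtSimplex (k + 1) p.vertex) : Loops p k :=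
  (exists_toFunctor_eq_simplex f).choose

theorem face_topCell (f : (simplicialNerve A).PtSimplex (k + 1) p.vertex) :
    face false (k + 1) (topCell f) = topCell f :=
  (exists_toFunctor_eq_simplex f).choose_spec.choose

theorem toFunctor_eq_simplex (f : (simplicialNerve A).PtSimplex (k + 1) p.vertex) :
    toFunctor f.map = simplex (topCell f) (face_topCell f) :=
  (exists_toFunctor_eq_simplex f).choose_spec.choose_spec

theorem topCell_const :
    topCell (SSet.RelativeMorphism.const : (simplicialNerve A).PtSimplex (k + 1) p.vertex) = 1 := by
  refine simplex_injective (hu' := map_one _) ((toFunctor_eq_simplex _).symm.trans ?_)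
  rw [simplex_one]
  exact toFunctor_const p _

theorem nonempty_mulStruct_iff (f g h : (simplicialNerve A).PtSimplex (k + 1) p.vertex) :
    Nonempty (SSet.PtSimplex.MulStruct g f h (Fin.last k)) ↔
      (topCell f : Pi p k) * topCell g = topCell h := by
  rw [← exists_comp_map_eq_simplex_iff (face_topCell f) (face_topCell g) (face_topCell h)]
  have n1 : (Fin.last k).castSucc.succ ≠ (Fin.last k).castSucc.castSucc :=
    fun h => by simp [Fin.ext_iff] at h
  have n2 : (Fin.last k).succ.succ ≠ (Fin.last k).castSucc.castSucc :=
    fun h => by simp [Fin.ext_iff] at h; omega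
  have n3 : (Fin.last k).succ.succ ≠ (Fin.last k).castSucc.succ :=
    fun h => by simp [Fin.ext_iff] at h
  have heq : ∀ {u u' : Loops p k} (hu : face false (k + 1) u = u) (e : u = u'),
      simplex u hu = simplex u' (e ▸ hu) := by
    rintro u _ hu rfl; rfl
  constructor
  · rintro ⟨w⟩
    refine ⟨toFunctor w.map, fun j => ?_⟩
    rw [← toFunctor_δ]
    rcases (show j < (Fin.last k).castSucc.castSucc ∨ j = (Fin.last k).castSucc.castSucc ∨
        j = (Fin.last k).castSucc.succ ∨ j = (Fin.last k).succ.succ by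
      simp only [Fin.lt_def, Fin.ext_iff, Fin.val_castSucc, Fin.val_succ, Fin.val_last]
      omega) with hj | rfl | rfl | rfl
    · rw [w.δ_map_of_lt j hj, toFunctor_const, ← simplex_one (k := k)]
      refine heq _ ?_
      rw [faceValue, if_neg hj.ne, if_neg, if_neg]
      · exact (hj.trans (by simp [Fin.lt_def])).ne
      · exact (hj.trans (by simp [Fin.lt_def])).ne
    · rw [w.δ_castSucc_castSucc_map, toFunctor_eq_simplex]
      exact heq _ (if_pos rfl).symm
    · rw [w.δ_succ_castSucc_map, toFunctor_eq_simplex]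
      refine heq _ ?_
      rw [faceValue, if_neg n1, if_pos rfl]
    · rw [w.δ_succ_succ_map, toFunctor_eq_simplex]
      refine heq _ ?_
      rw [faceValue, if_neg n2, if_neg n3, if_pos rfl]
  · rintro ⟨w, hw⟩
    obtain ⟨g', rfl⟩ := toFunctor_surjective w
    simp only [← toFunctor_δ] at hw
    refine ⟨SSet.PtSimplex.MulStruct.mk g' ?_ ?_ ?_ ?_ ?_⟩
    · refine toFunctor_injective ?_
      rw [hw, toFunctor_eq_simplex f]
      exact heq _ (if_pos rfl)
    · refine toFunctor_injective ?_
      rw [hw, toFunctor_eq_simplex h]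
      refine heq _ ?_
      rw [faceValue, if_neg n1, if_pos rfl]
    · refine toFunctor_injective ?_
      rw [hw, toFunctor_eq_simplex g]
      refine heq _ ?_
      rw [faceValue, if_neg n2, if_neg n3, if_pos rfl]
    · intro j hj
      refine toFunctor_injective ?_
      rw [hw, toFunctor_const, ← simplex_one (k := k)]
      refine heq _ ?_
      rw [faceValue, if_neg hj.ne, if_neg, if_neg]
      · exact (hj.trans (by simp [Fin.lt_def])).ne
      · exact (hj.trans (by simp [Fin.lt_def])).ne
    · intro j hj
      simp only [Fin.lt_def, Fin.val_succ, Fin.val_last] at hj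
      omega

/-- The simplicial homotopy groups of the nerve of an ω-groupoid are the globular ones. -/
noncomputable def piEquiv (p : Point A) (k : ℕ) :
    SimplicialPi (simplicialNerve A) (k + 1) p.vertex ≃ Pi p k := by
  have hrel : ∀ f g : (simplicialNerve A).PtSimplex (k + 1) p.vertex,
      Nonempty (SSet.PtSimplex.RelStruct f g (Fin.last (k + 1))) ↔
        (topCell f : Pi p k) = topCell g := by
    intro f g
    have := nonempty_mulStruct_iff SSet.RelativeMorphism.const g f
    rw [topCell_const, QuotientGroup.mk_one, one_mul] at this
    rw [eq_comm, ← this]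
    exact (SSet.PtSimplex.relStructSuccEquivMulStruct (i := Fin.last k)).nonempty_congr
  refine Equiv.ofBijective (Quot.lift (fun f => (topCell f : Pi p k))
    fun f g h => (hrel f g).1 h) ⟨?_, ?_⟩
  · rintro ⟨f⟩ ⟨g⟩ h
    exact Quot.sound ((hrel f g).2 h)
  · intro a
    induction a using QuotientGroup.induction_on with
    | H a =>
      obtain ⟨f, hf⟩ := exists_ptSimplex (simplex (face false (k + 1) a) (face_face _ _ _ _))
        fun σ hσ h => simplex_atom_of_ne _ _ hσ h
      refine ⟨Quot.mk _ f, ?_⟩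
      have : topCell f = face false (k + 1) a :=
        simplex_injective ((toFunctor_eq_simplex f).symm.trans hf)
      change (topCell f : Pi p k) = a
      rw [this]
      exact (QuotientGroup.eq.2 (face_mem_bounding a)).symm

theorem isHomotopyGroup (hk : 1 ≤ k + 1) : IsHomotopyGroup hk (piEquiv p k).group := by
  intro f g h
  change (piEquiv p k).symm _ = _ ↔ Nonempty (SSet.PtSimplex.MulStruct g f h (Fin.last k))
  rw [nonempty_mulStruct_iff, Equiv.symm_apply_eq]
  rfl

end Loops

end OmegaCat

/-! ### Composition of loops along the base points -/

namespace OmegaCat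

variable {C : Type u} [OmegaCat C] [NonContracting C]

/-- A `1`-morphism of `C`, as a base point of the path ω-category. -/
abbrev arrowPoint (φ : C) (hφ : HasDim φ 1) : Point (PathCat C) :=
  ⟨PathCat.ofArrow φ hφ, PathCat.d_ofArrow φ hφ⟩

namespace Loops

variable {φ ψ : C} {hφ : HasDim φ 1} {hψ : HasDim ψ 1} {k : ℕ}

theorem d_succ_val (a : Loops (arrowPoint φ hφ) k) (α : Bool) {m : ℕ} (hm : m ≤ k) :
    d α (m + 1) a.1.1 = φ :=
  congrArg Subtype.val (d_eq_of_le a α hm)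

theorem composable_zero (hφψ : d true 0 φ = d false 0 ψ) (a : Loops (arrowPoint φ hφ) k)
    (b : Loops (arrowPoint ψ hψ) k) : d true 0 a.1.1 = d false 0 b.1.1 := by
  rw [← d_d_of_lt true true 0 1 a.1.1 Nat.zero_lt_one, ← d_d_of_lt false false 0 1 b.1.1
    Nat.zero_lt_one, d_succ_val a true (Nat.zero_le k), d_succ_val b false (Nat.zero_le k), hφψ]

theorem d_succ_comp_zero (hφψ : d true 0 φ = d false 0 ψ) (a : Loops (arrowPoint φ hφ) k)
    (b : Loops (arrowPoint ψ hψ) k) (α : Bool) {m : ℕ} (hm : m ≤ k) :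
    d α (m + 1) (comp 0 a.1.1 b.1.1 (composable_zero hφψ a b)) = comp 0 φ ψ hφψ := by
  rw [d_comp α (m + 1) 0 _ _ (Nat.succ_ne_zero m) _
    (by rw [d_succ_val a α hm, d_succ_val b α hm, hφψ])]
  exact comp_congr (d_succ_val a α hm) (d_succ_val b α hm) _ _

/-- If the composite of the base points degenerates, then so do all composites of loops, because
`C` is non-contracting. -/
theorem comp_zero_eq_of_hasDim_zero (hφψ : d true 0 φ = d false 0 ψ)
    (h₀ : HasDim (comp 0 φ ψ hφψ) 0) (a : Loops (arrowPoint φ hφ) k)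
    (b : Loops (arrowPoint ψ hψ) k) :
    comp 0 a.1.1 b.1.1 (composable_zero hφψ a b) = comp 0 φ ψ hφψ := by
  have h1 := d_succ_comp_zero hφψ a b false (Nat.zero_le k)
  by_cases h : HasDim (comp 0 a.1.1 b.1.1 (composable_zero hφψ a b)) 0
  · rw [← h1, d_of_d_zero h.1]
  · have h2 := NonContracting.hasDim_one _ h false
    rw [h1] at h2
    exact absurd (h2.unique h₀) one_ne_zero

variable [IsOmegaGroupoid (PathCat C)]

/-- The composition `*_0` of `C`, as a homomorphism on loops. -/
def compZero (hφψ : d true 0 φ = d false 0 ψ) (h₁ : HasDim (comp 0 φ ψ hφψ) 1) :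
    Loops (arrowPoint φ hφ) k × Loops (arrowPoint ψ hψ) k →*
      Loops (arrowPoint (comp 0 φ ψ hφψ) h₁) k where
  toFun ab := ⟨⟨comp 0 ab.1.1.1 ab.2.1.1 (composable_zero hφψ ab.1 ab.2),
      not_hasDim_zero_of_d_one (x := comp 0 φ ψ hφψ)
        (fun h => absurd (h₁.unique h) one_ne_zero) false
        ((d_succ_comp_zero hφψ ab.1 ab.2 false (Nat.zero_le k)).trans (h₁.1 false).symm)⟩,
    fun α => Subtype.ext (d_succ_comp_zero hφψ ab.1 ab.2 α le_rfl)⟩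
  map_one' := rfl
  map_mul' ab ab' := Subtype.ext (Subtype.ext (interchange 0 (k + 1) ab.1.1.1 ab'.1.1.1 ab.2.1.1
    ab'.2.1.1 (Nat.succ_ne_zero k).symm _ _ _ _ _ _))

theorem coe_compZero (hφψ : d true 0 φ = d false 0 ψ) (h₁ : HasDim (comp 0 φ ψ hφψ) 1)
    (a : Loops (arrowPoint φ hφ) k) (b : Loops (arrowPoint ψ hψ) k) :
    (compZero hφψ h₁ (a, b)).1.1 = comp 0 a.1.1 b.1.1 (composable_zero hφψ a b) := rfl

theorem face_compZero (hφψ : d true 0 φ = d false 0 ψ) (h₁ : HasDim (comp 0 φ ψ hφψ) 1)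
    (α : Bool) (m : ℕ) (a : Loops (arrowPoint φ hφ) k) (b : Loops (arrowPoint ψ hψ) k) :
    face α m (compZero hφψ h₁ (a, b)) = compZero hφψ h₁ (face α m a, face α m b) :=
  Subtype.ext (Subtype.ext (d_comp α (m + 1) 0 a.1.1 b.1.1 (Nat.succ_ne_zero m) _ _))

theorem compZero_mem_bounding (hφψ : d true 0 φ = d false 0 ψ)
    (h₁ : HasDim (comp 0 φ ψ hφψ) 1) {a : Loops (arrowPoint φ hφ) k}
    {b : Loops (arrowPoint ψ hψ) k} (ha : a ∈ bounding (arrowPoint φ hφ) k)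
    (hb : b ∈ bounding (arrowPoint ψ hψ) k) :
    compZero hφψ h₁ (a, b) ∈ bounding (arrowPoint (comp 0 φ ψ hφψ) h₁) k := by
  obtain ⟨c, hc, hc'⟩ := ha
  obtain ⟨e, he, he'⟩ := hb
  refine ⟨compZero hφψ h₁ (c, e), ?_, ?_⟩
  · rw [face_compZero, hc, he, ← Prod.one_eq_mk, map_one]
  · rw [face_compZero, face_compZero, hc', he']

/-- The homomorphism induced by `*_0` on homotopy groups. -/
noncomputable def piCompZero (hφψ : d true 0 φ = d false 0 ψ) (h₁ : HasDim (comp 0 φ ψ hφψ) 1) :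
    Pi (arrowPoint φ hφ) k × Pi (arrowPoint ψ hψ) k →*
      Pi (arrowPoint (comp 0 φ ψ hφψ) h₁) k :=
  (QuotientGroup.map (bounding (arrowPoint φ hφ) k) (bounding (arrowPoint _ h₁) k)
      ((compZero hφψ h₁).comp (MonoidHom.inl _ (Loops (arrowPoint ψ hψ) k)))
      fun _ ha => compZero_mem_bounding hφψ h₁ ha (one_mem _)).noncommCoprod
    (QuotientGroup.map (bounding (arrowPoint ψ hψ) k) (bounding (arrowPoint _ h₁) k)
      ((compZero hφψ h₁).comp (MonoidHom.inr (Loops (arrowPoint φ hφ) k) _))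
      fun _ hb => compZero_mem_bounding hφψ h₁ (one_mem _) hb) (by
    intro a b
    induction a using QuotientGroup.induction_on with
    | H a =>
      induction b using QuotientGroup.induction_on with
      | H b =>
        have h : Commute ((a, 1) : Loops (arrowPoint φ hφ) k × Loops (arrowPoint ψ hψ) k)
            (1, b) := by
          simp [Commute, SemiconjBy]
        exact (h.map (compZero hφψ h₁)).map (QuotientGroup.mk' _))

theorem piCompZero_mk (hφψ : d true 0 φ = d false 0 ψ) (h₁ : HasDim (comp 0 φ ψ hφψ) 1)
    (a : Loops (arrowPoint φ hφ) k) (b : Loops (arrowPoint ψ hψ) k) :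
    piCompZero hφψ h₁ ((a : Pi _ k), (b : Pi _ k)) = (compZero hφψ h₁ (a, b) : Loops _ k) := by
  have h : compZero hφψ h₁ (a, b) =
      compZero hφψ h₁ (a, (1 : Loops (arrowPoint ψ hψ) k)) *
        compZero hφψ h₁ ((1 : Loops (arrowPoint φ hφ) k), b) := by
    rw [← map_mul, Prod.mk_mul_mk, mul_one, one_mul]
  rw [h]
  rfl

theorem eval_eq (x : (globularNerve C).PtSimplex (k + 1) (basePoint φ hφ))
    (c : Oriental (k + 1)) :
    eval x c = (topCell (p := arrowPoint φ hφ) x ^ c.cell false (k + 1) Finset.univ).1.1 :=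
  congrArg (fun F : Fun (Oriental (k + 1)) (PathCat C) => (F.toFun c).1)
    (toFunctor_eq_simplex (p := arrowPoint φ hφ) x)

theorem exists_ptSimplex_compZero (hφψ : d true 0 φ = d false 0 ψ)
    (h₁ : HasDim (comp 0 φ ψ hφψ) 1)
    (x : (globularNerve C).PtSimplex (k + 1) (basePoint φ hφ))
    (y : (globularNerve C).PtSimplex (k + 1) (basePoint ψ hψ)) :
    ∃ z : (globularNerve C).PtSimplex (k + 1) (basePoint (comp 0 φ ψ hφψ) h₁),
      (∀ c : Oriental (k + 1), ∃ h : d true 0 (eval x c) = d false 0 (eval y c),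
        eval z c = comp 0 (eval x c) (eval y c) h) ∧
      topCell (p := arrowPoint (comp 0 φ ψ hφψ) h₁) z =
        compZero hφψ h₁ (topCell (p := arrowPoint φ hφ) x, topCell (p := arrowPoint ψ hψ) y) := by
  have hface : face false (k + 1) (compZero hφψ h₁
      (topCell (p := arrowPoint φ hφ) x, topCell (p := arrowPoint ψ hψ) y)) =
      compZero hφψ h₁ (topCell (p := arrowPoint φ hφ) x, topCell (p := arrowPoint ψ hψ) y) :=
    (face_compZero hφψ h₁ _ _ _ _).trans (congrArg₂ (fun a b => compZero hφψ h₁ (a, b))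
      (face_topCell _) (face_topCell _))
  obtain ⟨z, hz⟩ := exists_ptSimplex (simplex _ hface) fun σ hσ h => simplex_atom_of_ne _ _ hσ h
  have hz' := simplex_injective ((toFunctor_eq_simplex z).symm.trans hz)
  refine ⟨z, fun c => ?_, hz'⟩
  have hx := eval_eq x c
  have hy := eval_eq y c
  refine ⟨by rw [hx, hy]; exact composable_zero hφψ _ _, (eval_eq z c).trans ?_⟩
  refine Eq.trans ?_ (comp_congr hx.symm hy.symm (composable_zero hφψ _ _) _)
  rw [← coe_compZero hφψ h₁, ← Prod.pow_mk, map_pow]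
  exact congrArg (fun a => (a ^ c.cell false (k + 1) Finset.univ).1.1) hz'

end Loops

end OmegaCat

open Loops

theorem proposition4p1 {C : Type u} [OmegaCat C] [NonContracting C] [IsOmegaGroupoid (PathCat C)]
    (n : ℕ) (hn : 1 ≤ n) (φ ψ : C) (hφ : HasDim φ 1) (hψ : HasDim ψ 1)
    (hφψ : d true 0 φ = d false 0 ψ) :
    (∀ h₁ : HasDim (comp 0 φ ψ hφψ) 1,
      ∃ (G₁ : Group (GlobularPi C n φ hφ)) (G₂ : Group (GlobularPi C n ψ hψ))
        (G₃ : Group (GlobularPi C n (comp 0 φ ψ hφψ) h₁)),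
        IsHomotopyGroup hn G₁ ∧ IsHomotopyGroup hn G₂ ∧ IsHomotopyGroup hn G₃ ∧
        ∃ F : GlobularPi C n φ hφ × GlobularPi C n ψ hψ →* GlobularPi C n (comp 0 φ ψ hφψ) h₁,
          ∀ (x : (globularNerve C).PtSimplex n (basePoint φ hφ))
            (y : (globularNerve C).PtSimplex n (basePoint ψ hψ)),
            ∃ z : (globularNerve C).PtSimplex n (basePoint (comp 0 φ ψ hφψ) h₁),
              (∀ c : Oriental n, ∃ h : d true 0 (eval x c) = d false 0 (eval y c),
                eval z c = comp 0 (eval x c) (eval y c) h) ∧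
              F (SimplicialPi.mk x, SimplicialPi.mk y) = SimplicialPi.mk z) ∧
    (HasDim (comp 0 φ ψ hφψ) 0 →
      ∃ F : GlobularPi C n φ hφ × GlobularPi C n ψ hψ → C,
        (∀ (x : (globularNerve C).PtSimplex n (basePoint φ hφ))
            (y : (globularNerve C).PtSimplex n (basePoint ψ hψ)) (c : Oriental n),
            ∃ h : d true 0 (eval x c) = d false 0 (eval y c),
              F (SimplicialPi.mk x, SimplicialPi.mk y) = comp 0 (eval x c) (eval y c) h) ∧
        ∀ p, F p = comp 0 φ ψ hφψ) := by
  obtain ⟨k, rfl⟩ : ∃ k, n = k + 1 := ⟨n - 1, by omega⟩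
  refine ⟨fun h₁ => ?_, fun h₀ => ⟨fun _ => comp 0 φ ψ hφψ, fun x y c => ?_, fun _ => rfl⟩⟩
  · let e₁ := piEquiv (arrowPoint φ hφ) k
    let e₂ := piEquiv (arrowPoint ψ hψ) k
    let e₃ := piEquiv (arrowPoint (comp 0 φ ψ hφψ) h₁) k
    let G₁ : Group (GlobularPi C (k + 1) φ hφ) := e₁.group
    let G₂ : Group (GlobularPi C (k + 1) ψ hψ) := e₂.group
    let G₃ : Group (GlobularPi C (k + 1) (comp 0 φ ψ hφψ) h₁) := e₃.group
    refine ⟨G₁, G₂, G₃, isHomotopyGroup hn, isHomotopyGroup hn, isHomotopyGroup hn,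
      { toFun := fun q => e₃.symm (piCompZero hφψ h₁ (e₁ q.1, e₂ q.2))
        map_one' := ?_
        map_mul' := ?_ }, fun x y => ?_⟩
    · change e₃.symm (piCompZero hφψ h₁ (e₁ (e₁.symm 1), e₂ (e₂.symm 1))) = e₃.symm 1
      rw [Equiv.apply_symm_apply, Equiv.apply_symm_apply, ← Prod.one_eq_mk, map_one]
    · intro q r
      change e₃.symm (piCompZero hφψ h₁ (e₁ (e₁.symm (e₁ q.1 * e₁ r.1)),
        e₂ (e₂.symm (e₂ q.2 * e₂ r.2)))) = e₃.symm (e₃ (e₃.symm _) * e₃ (e₃.symm _))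
      simp only [Equiv.apply_symm_apply]
      rw [← Prod.mk_mul_mk, map_mul]
    · obtain ⟨z, hz, hz'⟩ := exists_ptSimplex_compZero hφψ h₁ x y
      refine ⟨z, hz, ?_⟩
      exact (Equiv.symm_apply_eq e₃).2 ((piCompZero_mk hφψ h₁ _ _).trans
        (congrArg (QuotientGroup.mk (s := bounding (arrowPoint _ h₁) k)) hz'.symm))
  · simp only [eval_eq]
    exact ⟨composable_zero hφψ _ _, (comp_zero_eq_of_hasDim_zero hφψ h₀ _ _).symm⟩
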